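/- **Setting.** Let $A$ be a nonempty finite set with a fixed linear order, $Z$ a finite set and $T\in\mathbb N$. An *environment* is a family $\nu=(\nu_a)_{a\in A}$ of probability measures on $Z\times[0,1]$. In each round $t=1,\dots,T$ independent pairs $(Z_t(a),Y_t(a))\sim\nu_a$, $a\in A$, are drawn, independently over the rounds. A policy chooses $A_t$ as a measurable function of the observed history $(A_s,Z_s,Y_s)_{s<t}$, where $Z_s=Z_s(A_s)$ and $Y_s=Y_s(A_s)$. Its regret is $R(T)=T\max_{a}\mathbb E_{\nu_a}[Y]-\mathbb E\sum_{t=1}^T\mathbb E_{\nu_{A_t}}[Y]$, where $\mathbb E_{\nu_a}[Y]$ is the mean reward of $a$. The environment is *conditionally benign* if there is a probability measure $p$ on $Z\times[0,1]$ such that for every $a$ one has $\nu_a(Z)\ll p(Z)$ for the context marginals, and $\nu_a(Y\mid Z=z)=p(Y\mid Z=z)$ for every $z$ with $\nu_a(Z=z)>0$. *Approximate marginals* are any family $\tilde\nu=(\tilde\nu_a)_{a\in A}$ of probability measures on $Z$; they are *$\varepsilon$-close* to those of $\nu$ if $\max_a\sum_{z}|\tilde\nu_a(z)-\nu_a(Z=z)|\le\varepsilon$.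 **HAC-UCB.** Put $\delta=2/T^2$ and $\kappa=T^{-1/4}\sqrt{|A||Z|\log T}$. Let $N_t(a)$ be the maximum of $1$ and the number of rounds $s\le t$ with $A_s=a$, and $\hat\mu_t(a)=N_t(a)^{-1}\sum_{s\le t,\,A_s=a}Y_s$; define $N_t(z)$ and $\hat\mu_t(z)$ for $z\in Z$ in the same way, using the rounds with $Z_s=z$. Let $U_t(a)=\hat\mu_t(a)+\sqrt{\log(2/\delta)/(2N_t(a))}$, $U_t(z)=\hat\mu_t(z)+\sqrt{\log(2/\delta)/(2N_t(z))}$ and $\tilde U_t(a)=\sum_z U_t(z)\,\tilde\nu_a(z)$. The algorithm, stopped after round $T$, is: 1. Play each action, in order, for $\lceil 4\sqrt T/|A|\rceil$ rounds, and let $\hat\nu_a$ be the empirical distribution of the context over the rounds of this phase in which $a$ was played. If $\max_a\sum_z|\tilde\nu_a(z)-\hat\nu_a(z)|>2\kappa$, replace $\tilde\nu$ by $\hat\nu$ from here on. 2. Play each action, in order, for $\lceil\sqrt T/|A|\rceil$ further rounds. 3. In each later round $t$, let $D(a)=U_{t-1}(a)-\tilde U_{t-1}(a)+\kappa$ and test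 whether for all $a\in A$ $$-2\sum_{z\in Z}\sqrt{\frac{\log T}{N_{t-1}(z)}}\,\tilde\nu_a(z)\ \le\ D(a)\ \le\ 2\sqrt{\frac{\log T}{N_{t-1}(a)}}+2\kappa .$$ If this test and all earlier ones have passed, play the maximizer of $\tilde U_{t-1}$ over $A$; otherwise play the maximizer of $U_{t-1}$ over $A$ (ties go to the smallest action). **Theorem.** For all such $A$, $Z$, every $T\ge 25|A|^2$, every environment $\nu$ and all approximate marginals $\tilde\nu$, the regret of HAC-UCB satisfies $$R(T)\le 4|A|+11\,T^{3/4}(\log T)\sqrt{|A||Z|}+15\sqrt{(|A|+|Z|)T\log T}+5(\log T)\sqrt T .$$ Moreover, for every $\varepsilon\le T^{-1/4}\sqrt{|A||Z|\log T}$, if $\nu$ is conditionally benign and $\tilde\nu$ is $\varepsilon$-close to the context marginals of $\nu$, then $$R(T)\le 4|A|+2|Z|+6\sqrt{|Z|T\log T}+4(\log T)\sqrt T+2\varepsilon\bigl(1+\sqrt{\log T}\bigr)T .$$ -/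

import Mathlib

open MeasureTheory ProbabilityTheory

namespace CausalBandit

/-! ### Environments, policies and regret -/

/-- What is observed in one round: the action played, the post-action context, the reward. -/
abbrev Obs (A Z : Type*) : Type _ := A × Z × unitInterval

/-- An environment: a family, indexed by the actions, of joint laws of the context and the
reward, the reward space being `[0, 1]`. -/
abbrev Env (A Z : Type*) [MeasurableSpace Z] : Type _ :=
  A → ProbabilityMeasure (Z × unitInterval)

/-- A policy for `T` rounds: a measurable map from histories of length `t` to actions for each
`t < T`. Rounds are numbered from `0`, so the map of index `t` selects the action of the
`(t + 1)`-st round. -/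
structure Policy (A Z : Type*) [MeasurableSpace A] [MeasurableSpace Z] (T : ℕ) where
  act : ∀ t : Fin T, (Fin t → Obs A Z) → A
  measurable_act : ∀ t : Fin T, Measurable (act t)

/-- A table of potential outcomes: for each round and each action, the context and the reward
that this action yields in this round. -/
abbrev Outcomes (A Z : Type*) (T : ℕ) : Type _ := Fin T → A → Z × unitInterval

section Interaction

variable {A Z : Type*} [MeasurableSpace A] [MeasurableSpace Z] {T : ℕ}

/-- The law of the potential outcomes: all rounds and actions independent, the outcome of the
action `a` having the law `ν a` in each round. -/
noncomputable def outcomeLaw [Fintype A] (ν : Env A Z) (T : ℕ) : Measure (Outcomes A Z T) :=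
  Measure.pi fun _ : Fin T => Measure.pi fun a : A => (ν a : Measure (Z × unitInterval))

/-- The observed history of the first `n` rounds when the policy `π` is played. -/
def history (π : Policy A Z T) (ω : Outcomes A Z T) : ∀ n : ℕ, n ≤ T → Fin n → Obs A Z
  | 0, _ => Fin.elim0
  | n + 1, hn =>
      Fin.snoc (α := fun _ => Obs A Z) (history π ω n (Nat.le_of_succ_le hn))
        (π.act ⟨n, hn⟩ (history π ω n (Nat.le_of_succ_le hn)),
          ω ⟨n, hn⟩ (π.act ⟨n, hn⟩ (history π ω n (Nat.le_of_succ_le hn))))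

/-- The action that the policy `π` plays in round `t`. -/
def playedAction (π : Policy A Z T) (ω : Outcomes A Z T) (t : Fin T) : A :=
  π.act t (history π ω t t.isLt.le)

/-- The mean reward of the action `a`. -/
noncomputable def meanReward (ν : Env A Z) (a : A) : ℝ :=
  ∫ x, (x.2 : ℝ) ∂(ν a : Measure (Z × unitInterval))

/-- The regret of a policy:
`T * max_a E_a[Y]` minus the expected value of `∑ t, E_{A_t}[Y]`. -/
noncomputable def regret [Fintype A] [Nonempty A] (ν : Env A Z) (π : Policy A Z T) : ℝ :=
  T * Finset.univ.sup' Finset.univ_nonempty (meanReward ν)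
    - ∫ ω, ∑ t : Fin T, meanReward ν (playedAction π ω t) ∂(outcomeLaw ν T)

/-- The probability that the context equals `z` under the action `a`. -/
noncomputable def contextProb (ν : Env A Z) (a : A) (z : Z) : ℝ :=
  (ν a : Measure (Z × unitInterval)).real (Prod.fst ⁻¹' {z})

/-- The environment is conditionally benign: there is one joint law `p` such that, for each
action `a`, the marginal law of the context under `ν a` is absolutely continuous with respect to
that under `p`, and the conditional law of the reward given the context is the same under `ν a`
as under `p`. The context space is finite, and the conditional law of the reward under `ν a` is
determined at exactly those `z` that have positive probability under `ν a`. -/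
def ConditionallyBenign (ν : Env A Z) : Prop :=
  ∃ p : ProbabilityMeasure (Z × unitInterval), ∀ a : A,
    (ν a : Measure (Z × unitInterval)).map Prod.fst
        ≪ (p : Measure (Z × unitInterval)).map Prod.fst ∧
      ∀ z : Z, (ν a : Measure (Z × unitInterval)) (Prod.fst ⁻¹' {z}) ≠ 0 →
        (cond (ν a : Measure (Z × unitInterval)) (Prod.fst ⁻¹' {z})).map Prod.snd
          = (cond (p : Measure (Z × unitInterval)) (Prod.fst ⁻¹' {z})).map Prod.snd

/-- The approximate marginals `q` are `ε`-close to the context marginals of `ν`. -/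
def EpsClose [Fintype Z] (q : A → ProbabilityMeasure Z) (ν : Env A Z) (ε : ℝ) : Prop :=
  ∀ a : A, ∑ z, |(q a : Measure Z).real {z} - contextProb ν a z| ≤ ε

end Interaction

/-! ### Statistics of a history and upper confidence bounds -/

section Statistics

variable {A Z : Type*} [DecidableEq A] [DecidableEq Z] {n : ℕ}

/-- `1 ∨` the number of rounds in which the context was `z`. -/
noncomputable def contextCount (h : Fin n → Obs A Z) (z : Z) : ℝ :=
  max 1 (∑ s, if (h s).2.1 = z then 1 else 0)

/-- `1 ∨` the number of rounds in which the action was `a`. -/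
noncomputable def actionCount (h : Fin n → Obs A Z) (a : A) : ℝ :=
  max 1 (∑ s, if (h s).1 = a then 1 else 0)

/-- The empirical mean reward of the rounds in which the context was `z`. -/
noncomputable def contextMean (h : Fin n → Obs A Z) (z : Z) : ℝ :=
  (contextCount h z)⁻¹ * ∑ s, if (h s).2.1 = z then ((h s).2.2 : ℝ) else 0

/-- The empirical mean reward of the rounds in which the action was `a`. -/
noncomputable def actionMean (h : Fin n → Obs A Z) (a : A) : ℝ :=
  (actionCount h a)⁻¹ * ∑ s, if (h s).1 = a then ((h s).2.2 : ℝ) else 0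

/-- The upper confidence bound of the action `a`, with confidence parameter `δ`. -/
noncomputable def ucbAction (δ : ℝ) (h : Fin n → Obs A Z) (a : A) : ℝ :=
  actionMean h a + √(Real.log (2 / δ) / (2 * actionCount h a))

/-- The upper confidence bound of the context `z`, with confidence parameter `δ`. -/
noncomputable def ucbContext (δ : ℝ) (h : Fin n → Obs A Z) (z : Z) : ℝ :=
  contextMean h z + √(Real.log (2 / δ) / (2 * contextCount h z))

/-- The pseudo upper confidence bound of the action `a`: the upper confidence bounds of the
contexts averaged with the weights `w a`. -/
noncomputable def pseudoUCB [Fintype Z] (δ : ℝ) (w : A → Z → ℝ) (h : Fin n → Obs A Z)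
    (a : A) : ℝ :=
  ∑ z, ucbContext δ h z * w a z

end Statistics

/-! ### The algorithm -/

section Algorithm

variable {A Z : Type*} [Fintype A] [LinearOrder A] [Fintype Z] [DecidableEq Z]

open Classical in
/-- The maximizer of `f`, ties being broken in favour of the smallest action. -/
noncomputable def argmax [Nonempty A] (f : A → ℝ) : A :=
  (Finset.univ.filter fun a => ∀ b, f b ≤ f a).min' (by
    obtain ⟨a, ha⟩ := Finite.exists_max f
    exact ⟨a, by simpa using ha⟩)

/-- The number of rounds that the first exploration phase spends on each action. -/
noncomputable def explore₁ (A : Type*) [Fintype A] (T : ℕ) : ℕ := ⌈4 * √(T : ℝ) / Fintype.card A⌉₊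

/-- The number of rounds that the second exploration phase spends on each action. -/
noncomputable def explore₂ (A : Type*) [Fintype A] (T : ℕ) : ℕ := ⌈√(T : ℝ) / Fintype.card A⌉₊

/-- The maximum likelihood estimate of the context marginals from the first exploration phase:
among the rounds of that phase in which `a` was played, the proportion of those in which the
context was `z`. -/
noncomputable def mle (T : ℕ) {n : ℕ} (h : Fin n → Obs A Z) (a : A) (z : Z) : ℝ :=
  (∑ s : Fin n, if (s : ℕ) < Fintype.card A * explore₁ A T ∧ (h s).1 = a ∧ (h s).2.1 = z
      then 1 else 0)
    / ∑ s : Fin n, if (s : ℕ) < Fintype.card A * explore₁ A T ∧ (h s).1 = a then 1 else 0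

/-- The number `√(|A| |Z| log T) / T^(1/4)`. -/
noncomputable def tolerance (A Z : Type*) [Fintype A] [Fintype Z] (T : ℕ) : ℝ :=
  √(Fintype.card A * Fintype.card Z * Real.log T) / (T : ℝ) ^ (1 / 4 : ℝ)

open Classical in
/-- The marginals used after the first exploration phase: the given ones, or their maximum
likelihood estimate if the two are too far apart for some action. -/
noncomputable def workingMarginals (T : ℕ) (w : A → Z → ℝ) {n : ℕ} (h : Fin n → Obs A Z) :
    A → Z → ℝ :=
  if ∃ a, ∑ z, |w a z - mle T h a z| > 2 * tolerance A Z T then mle T h else w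

/-- The confidence parameter. -/
noncomputable def confidence (T : ℕ) : ℝ := 2 / (T : ℝ) ^ 2

/-- The difference of the two upper confidence bounds that the hypothesis test examines. -/
noncomputable def ucbDiff (T : ℕ) (w : A → Z → ℝ) {n : ℕ} (h : Fin n → Obs A Z) (a : A) : ℝ :=
  ucbAction (confidence T) h a - pseudoUCB (confidence T) (workingMarginals T w h) h a
    + tolerance A Z T

/-- The hypothesis test, performed after the history `h`, passes. -/
def TestPasses (T : ℕ) (w : A → Z → ℝ) {n : ℕ} (h : Fin n → Obs A Z) : Prop :=
  ∀ a : A,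
    -2 * ∑ z, √(Real.log T / contextCount h z) * workingMarginals T w h a z ≤ ucbDiff T w h a ∧
      ucbDiff T w h a ≤ 2 * √(Real.log T / actionCount h a) + 2 * tolerance A Z T

/-- The flag is still up after the history `h`: each test performed since the end of the
exploration, the present one included, has passed. -/
def FlagUp (T : ℕ) (w : A → Z → ℝ) {n : ℕ} (h : Fin n → Obs A Z) : Prop :=
  ∀ k : Fin (n + 1), Fintype.card A * (explore₁ A T + explore₂ A T) ≤ k →
    TestPasses T w fun s : Fin k => h (s.castLE (Nat.le_of_lt_succ k.isLt))

open Classical in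
/-- The action chosen after the history `h` of length `n`. In each exploration phase the actions
are played one after the other in their order, each for the prescribed number of rounds; then
the pseudo upper confidence bound is maximized as long as the flag is up, and the ordinary upper
confidence bound once it is down. -/
noncomputable def hacAct [Nonempty A] (T : ℕ) (w : A → Z → ℝ) (n : ℕ) (h : Fin n → Obs A Z) : A :=
  if h₁ : n < Fintype.card A * explore₁ A T then
    Fintype.orderIsoFinOfCardEq A rfl
      ⟨n / explore₁ A T, Nat.div_lt_of_lt_mul (lt_of_lt_of_eq h₁ (Nat.mul_comm _ _))⟩
  else if h₂ : n - Fintype.card A * explore₁ A T < Fintype.card A * explore₂ A T then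
    Fintype.orderIsoFinOfCardEq A rfl
      ⟨(n - Fintype.card A * explore₁ A T) / explore₂ A T,
        Nat.div_lt_of_lt_mul (lt_of_lt_of_eq h₂ (Nat.mul_comm _ _))⟩
  else if FlagUp T w h then argmax (pseudoUCB (confidence T) (workingMarginals T w h) h)
  else argmax (ucbAction (confidence T) h)

end Algorithm

/-! ### Measurability of the algorithm -/

section Measurability

theorem measurable_sum_ite {A Z : Type*} [MeasurableSpace A] [MeasurableSpace Z] {n : ℕ}
    {p : Obs A Z → Prop} [DecidablePred p]
    (hp : MeasurableSet {o | p o}) {f : Obs A Z → ℝ} (hf : Measurable f) :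
    Measurable fun h : Fin n → Obs A Z => ∑ s, if p (h s) then f (h s) else 0 :=
  Finset.measurable_sum _ fun s _ =>
    (Measurable.ite hp hf measurable_const).comp (measurable_pi_apply s)

theorem measurableSet_action {A Z : Type*} [MeasurableSpace A] [DiscreteMeasurableSpace A]
    [MeasurableSpace Z] (a : A) : MeasurableSet {o : Obs A Z | o.1 = a} :=
  measurable_fst (measurableSet_singleton a)

theorem measurableSet_context {A Z : Type*} [MeasurableSpace A] [MeasurableSpace Z]
    [DiscreteMeasurableSpace Z] (z : Z) : MeasurableSet {o : Obs A Z | o.2.1 = z} :=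
  (measurable_fst.comp measurable_snd) (measurableSet_singleton z)

theorem measurable_reward {A Z : Type*} [MeasurableSpace A] [MeasurableSpace Z] :
    Measurable fun o : Obs A Z => (o.2.2 : ℝ) :=
  measurable_subtype_coe.comp (measurable_snd.comp measurable_snd)

theorem measurable_argmax {A Ω : Type*} [Fintype A] [LinearOrder A] [Nonempty A]
    [MeasurableSpace A] [MeasurableSpace Ω] {f : Ω → A → ℝ}
    (hf : ∀ a, Measurable fun ω => f ω a) : Measurable fun ω => argmax (f ω) := by
  classical
  have hM : ∀ a, MeasurableSet {ω | ∀ b, f ω b ≤ f ω a} := fun a => by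
    rw [Set.ofPred_forall]
    exact MeasurableSet.iInter fun b => measurableSet_le (hf b) (hf a)
  refine measurable_to_countable' fun a => ?_
  have : (fun ω => argmax (f ω)) ⁻¹' {a}
      = {ω | ∀ b, f ω b ≤ f ω a} ∩ ⋂ c : A, ⋂ _ : c < a, {ω | ∀ b, f ω b ≤ f ω c}ᶜ := by
    ext ω
    simp only [Set.mem_preimage, Set.mem_singleton_iff, argmax, Finset.min'_eq_iff,
      Finset.mem_filter, Finset.mem_univ, true_and, Set.mem_inter_iff, Set.mem_ofPred_eq,
      Set.mem_iInter, Set.mem_compl_iff]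
    refine and_congr_right fun _ => ⟨fun h c hc hm => (h c hm).not_gt hc, fun h c hm => ?_⟩
    exact le_of_not_gt fun hc => h c hc hm
  rw [this]
  exact (hM a).inter
    (MeasurableSet.iInter fun c => MeasurableSet.iInter fun _ => (hM c).compl)

theorem measurable_contextCount {A Z : Type*} [DecidableEq Z] [MeasurableSpace A] [MeasurableSpace Z]
    [DiscreteMeasurableSpace Z] {n : ℕ} (z : Z) :
    Measurable fun h : Fin n → Obs A Z => contextCount h z :=
  measurable_const.max (measurable_sum_ite (measurableSet_context z) measurable_const)

theorem measurable_actionCount {A Z : Type*} [DecidableEq A] [MeasurableSpace A] [DiscreteMeasurableSpace A]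
    [MeasurableSpace Z] {n : ℕ} (a : A) :
    Measurable fun h : Fin n → Obs A Z => actionCount h a :=
  measurable_const.max (measurable_sum_ite (measurableSet_action a) measurable_const)

theorem measurable_ucbContext {A Z : Type*} [DecidableEq Z] [MeasurableSpace A] [MeasurableSpace Z]
    [DiscreteMeasurableSpace Z] {n : ℕ} (δ : ℝ) (z : Z) :
    Measurable fun h : Fin n → Obs A Z => ucbContext δ h z :=
  ((measurable_contextCount z).inv.mul
    (measurable_sum_ite (measurableSet_context z) measurable_reward)).add
    (measurable_const.div (measurable_const.mul (measurable_contextCount z))).sqrt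

theorem measurable_ucbAction {A Z : Type*} [DecidableEq A] [MeasurableSpace A] [DiscreteMeasurableSpace A]
    [MeasurableSpace Z] {n : ℕ} (δ : ℝ) (a : A) :
    Measurable fun h : Fin n → Obs A Z => ucbAction δ h a :=
  ((measurable_actionCount a).inv.mul
    (measurable_sum_ite (measurableSet_action a) measurable_reward)).add
    (measurable_const.div (measurable_const.mul (measurable_actionCount a))).sqrt

variable {A Z : Type*} [Fintype A] [LinearOrder A] [MeasurableSpace A] [DiscreteMeasurableSpace A]
  [Fintype Z] [DecidableEq Z] [MeasurableSpace Z] [DiscreteMeasurableSpace Z] {n : ℕ}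

theorem measurable_mle (T : ℕ) (a : A) (z : Z) :
    Measurable fun h : Fin n → Obs A Z => mle T h a z := by
  have ha : ∀ s : Fin n, MeasurableSet {h : Fin n → Obs A Z | (h s).1 = a} := fun s =>
    (measurable_fst.comp (measurable_pi_apply s)) (measurableSet_singleton a)
  have hz : ∀ s : Fin n, MeasurableSet {h : Fin n → Obs A Z | (h s).2.1 = z} := fun s =>
    (measurable_fst.comp (measurable_snd.comp (measurable_pi_apply s))) (measurableSet_singleton z)
  exact Measurable.div
    (Finset.measurable_sum _ fun s _ => Measurable.ite
      ((MeasurableSet.const _).inter ((ha s).inter (hz s))) measurable_const measurable_const)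
    (Finset.measurable_sum _ fun s _ => Measurable.ite
      ((MeasurableSet.const _).inter (ha s)) measurable_const measurable_const)

theorem measurable_workingMarginals (T : ℕ) (w : A → Z → ℝ) (a : A) (z : Z) :
    Measurable fun h : Fin n → Obs A Z => workingMarginals T w h a z := by
  classical
  have hS : MeasurableSet {h : Fin n → Obs A Z |
      ∃ a, ∑ z, |w a z - mle T h a z| > 2 * tolerance A Z T} := by
    rw [Set.ofPred_exists]
    refine MeasurableSet.iUnion fun b => measurableSet_lt measurable_const ?_
    exact Finset.measurable_sum _ fun z _ =>
      (measurable_const.sub (measurable_mle T b z)).abs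
  unfold workingMarginals
  simp only [ite_apply]
  exact Measurable.ite hS (measurable_mle T a z) measurable_const

theorem measurable_pseudoUCB (T : ℕ) (w : A → Z → ℝ) (a : A) :
    Measurable fun h : Fin n → Obs A Z =>
      pseudoUCB (confidence T) (workingMarginals T w h) h a :=
  Finset.measurable_sum _ fun z _ =>
    (measurable_ucbContext _ z).mul (measurable_workingMarginals T w a z)

theorem measurableSet_testPasses (T : ℕ) (w : A → Z → ℝ) :
    MeasurableSet {h : Fin n → Obs A Z | TestPasses T w h} := by
  have hd : ∀ a, Measurable fun h : Fin n → Obs A Z => ucbDiff T w h a := fun a =>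
    ((measurable_ucbAction _ a).sub (measurable_pseudoUCB T w a)).add measurable_const
  unfold TestPasses
  rw [Set.ofPred_forall]
  refine MeasurableSet.iInter fun a => MeasurableSet.inter ?_ ?_
  · refine measurableSet_le (measurable_const.mul ?_) (hd a)
    exact Finset.measurable_sum _ fun z _ =>
      (measurable_const.div (measurable_contextCount z)).sqrt.mul
        (measurable_workingMarginals T w a z)
  · exact measurableSet_le (hd a)
      ((measurable_const.mul (measurable_const.div (measurable_actionCount a)).sqrt).add
        measurable_const)

theorem measurableSet_flagUp (T : ℕ) (w : A → Z → ℝ) :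
    MeasurableSet {h : Fin n → Obs A Z | FlagUp T w h} := by
  unfold FlagUp
  simp only [Set.ofPred_forall]
  refine MeasurableSet.iInter fun k => MeasurableSet.iInter fun _ => ?_
  have hr : Measurable fun (h : Fin n → Obs A Z) (s : Fin k) =>
      h (s.castLE (Nat.le_of_lt_succ k.isLt)) :=
    measurable_pi_lambda _ fun s => measurable_pi_apply _
  exact hr (measurableSet_testPasses T w)

theorem measurable_hacAct [Nonempty A] (T : ℕ) (w : A → Z → ℝ) (n : ℕ) :
    Measurable fun h : Fin n → Obs A Z => hacAct T w n h := by
  classical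
  unfold hacAct
  split_ifs
  · exact measurable_const
  · exact measurable_const
  · exact Measurable.ite (measurableSet_flagUp T w)
      (measurable_argmax (measurable_pseudoUCB T w))
      (measurable_argmax (measurable_ucbAction (confidence T)))

/-- The policy HAC-UCB for `T` rounds with the approximate context marginals `q`. -/
noncomputable def hacUCB [Nonempty A] (T : ℕ) (q : A → ProbabilityMeasure Z) : Policy A Z T where
  act t h := hacAct T (fun a z => (q a : Measure Z).real {z}) t h
  measurable_act t := measurable_hacAct T _ t

end Measurability

end CausalBandit

/-! Both bounds rest on one event of high probability on which every confidence interval that is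
used is valid; on its complement, as in the exploration rounds, a regret of at most 1 per round is
conceded.

Concentration. The policy is adaptive, but the row of outcomes of round `t` is independent of the
history before `t`, so given that history the observation has the law of the action played
(`lintegral_history_roundObs`). If the conditional mean of `g` given `P` is the same number under
every action, Hoeffding's lemma makes an exponential of the accumulated deviation a supermartingale,
and Ville's inequality controls it at all times (`measure_le_deviation_le`,
`measure_not_mem_confidence_le`). With `P` fixing the action this covers the arms of every
environment. With `P` fixing the context it needs a conditional mean common to all actions, which is
what benignity supplies (`exists_conditional_mean`). The same inequality, applied to the indicators
of all sets of contexts, makes the empirical marginals of the first phase `tolerance`-accurate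
(`measure_mle_far_le`).

General bound. While the test passes, the two upper bounds are comparable, so maximizing the pseudo
bound costs little more than ordinary UCB, even in an environment that is not benign
(`meanReward_le_of_testPasses`). The extra cost per round is of order `√(log T)` times the
tolerance, which summed over `T` rounds gives the term in `T^(3/4)`. Once a test fails, the ordinary
UCB argument applies.

Benign bound. The context intervals are now valid as well. The given marginals are never discarded
and no test ever fails (`workingMarginals_eq_self`, `testPasses_of_within`), so UCB over the
contexts runs until the end (`meanReward_le_of_argmax_pseudoUCB`), and the action widths disappear
from the bound.

Summation. `regret_le` turns an estimate per round into a regret bound: inverse square roots of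
counts are summed by a telescoping estimate and Cauchy–Schwarz, after the context width has been
identified in expectation with the width at the context actually seen (`integral_contextWidth`). -/

namespace CausalBandit

/-! ### Resampling one round -/

section Resampling

open scoped ENNReal

variable {A Z : Type*} [MeasurableSpace A] [MeasurableSpace Z] {T : ℕ}

/-- The observation made in round `t` when the policy `π` is played. -/
def roundObs (π : Policy A Z T) (ω : Outcomes A Z T) (t : Fin T) : Obs A Z :=
  (playedAction π ω t, ω t (playedAction π ω t))

theorem history_succ (π : Policy A Z T) (ω : Outcomes A Z T) (n : ℕ) (hn : n + 1 ≤ T) :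
    history π ω (n + 1) hn = Fin.snoc (α := fun _ => Obs A Z)
      (history π ω n (Nat.le_of_succ_le hn)) (roundObs π ω ⟨n, hn⟩) := rfl

theorem history_apply (π : Policy A Z T) (ω : Outcomes A Z T) :
    ∀ (n : ℕ) (hn : n ≤ T) (s : Fin n), history π ω n hn s = roundObs π ω (s.castLE hn)
  | 0, _, s => s.elim0
  | n + 1, hn, s => by
    rw [history_succ]
    refine Fin.lastCases ?_ (fun i => ?_) s
    · rw [Fin.snoc_last]; rfl
    · rw [Fin.snoc_castSucc, history_apply π ω n]; rfl

theorem history_comp_castLE (π : Policy A Z T) (ω : Outcomes A Z T) {k n : ℕ} (hk : k ≤ n)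
    (hn : n ≤ T) :
    (fun s : Fin k => history π ω n hn (s.castLE hk)) = history π ω k (hk.trans hn) := by
  ext1 s
  rw [history_apply, history_apply]; rfl

/-- A policy does not look ahead: each action is a function of earlier observations. This is what
permits resampling row `t` without changing the history before it. -/
theorem history_congr (π : Policy A Z T) {ω ω' : Outcomes A Z T} :
    ∀ (n : ℕ) (hn : n ≤ T), (∀ s : Fin T, (s : ℕ) < n → ω s = ω' s) →
      history π ω n hn = history π ω' n hn
  | 0, _, _ => by ext1 s; exact s.elim0
  | n + 1, hn, h => by
    have ih := history_congr π n (Nat.le_of_succ_le hn) fun s hs => h s (hs.trans n.lt_succ_self)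
    simp only [history]
    rw [ih, h ⟨n, hn⟩ n.lt_succ_self]

theorem measurable_snoc {n : ℕ} : Measurable fun p : (Fin n → Obs A Z) × Obs A Z =>
    (Fin.snoc (α := fun _ => Obs A Z) p.1 p.2 : Fin (n + 1) → Obs A Z) := by
  refine measurable_pi_lambda _ fun s => ?_
  refine Fin.lastCases ?_ (fun i => ?_) s
  · simpa only [Fin.snoc_last] using measurable_snd
  · simp only [Fin.snoc_castSucc]
    exact (measurable_pi_apply i).comp measurable_fst

/-- The functional `M` has reached the level `c` along the history. -/
def Reached (M : ∀ n : ℕ, (Fin n → Obs A Z) → ℝ≥0∞) (c : ℝ≥0∞) :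
    ∀ n : ℕ, (Fin n → Obs A Z) → Prop
  | 0, h => c ≤ M 0 h
  | n + 1, h => Reached M c n (Fin.init (α := fun _ => Obs A Z) h) ∨ c ≤ M (n + 1) h

theorem measurableSet_reached {M : ∀ n : ℕ, (Fin n → Obs A Z) → ℝ≥0∞}
    (hM : ∀ n, Measurable (M n)) (c : ℝ≥0∞) :
    ∀ n : ℕ, MeasurableSet {h : Fin n → Obs A Z | Reached M c n h}
  | 0 => measurableSet_le measurable_const (hM 0)
  | n + 1 => by
    have hi : Measurable fun h : Fin (n + 1) → Obs A Z => Fin.init (α := fun _ => Obs A Z) h :=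
      measurable_pi_lambda _ fun i => measurable_pi_apply _
    exact (hi (measurableSet_reached hM c n)).union (measurableSet_le measurable_const (hM _))

theorem reached_history {M : ∀ n : ℕ, (Fin n → Obs A Z) → ℝ≥0∞} {c : ℝ≥0∞}
    (π : Policy A Z T) (ω : Outcomes A Z T) {k : ℕ} (hk : k ≤ T)
    (hc : c ≤ M k (history π ω k hk)) :
    ∀ (n : ℕ) (hn : n ≤ T), k ≤ n → Reached M c n (history π ω n hn)
  | 0, _, h => by
    obtain rfl : k = 0 := Nat.le_zero.mp h
    exact hc
  | n + 1, hn, h => by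
    rcases Nat.lt_or_ge n k with h' | h'
    · obtain rfl : k = n + 1 := le_antisymm h h'
      exact Or.inr hc
    · left
      rw [history_succ, Fin.init_snoc]
      exact reached_history π ω hk hc n _ h'

variable [Fintype A] [DiscreteMeasurableSpace A]

theorem measurable_history (π : Policy A Z T) :
    ∀ (n : ℕ) (hn : n ≤ T), Measurable fun ω : Outcomes A Z T => history π ω n hn
  | 0, _ => measurable_pi_lambda _ fun s => s.elim0
  | n + 1, hn => by
    have ih := measurable_history π n (Nat.le_of_succ_le hn)
    have hact : Measurable fun ω : Outcomes A Z T =>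
        π.act ⟨n, hn⟩ (history π ω n (Nat.le_of_succ_le hn)) :=
      (π.measurable_act ⟨n, hn⟩).comp ih
    have hout : Measurable fun p : A × Outcomes A Z T => p.2 ⟨n, hn⟩ p.1 :=
      measurable_from_prod_countable_right fun a =>
        (measurable_pi_apply a).comp (measurable_pi_apply _)
    refine measurable_pi_lambda _ fun s => ?_
    simp only [history]
    refine Fin.lastCases ?_ (fun i => ?_) s
    · simp only [Fin.snoc_last]
      exact hact.prodMk (hout.comp (hact.prodMk measurable_id))
    · simp only [Fin.snoc_castSucc]
      exact (measurable_pi_apply i).comp ih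

theorem measurable_playedAction (π : Policy A Z T) (t : Fin T) :
    Measurable fun ω : Outcomes A Z T => playedAction π ω t :=
  (π.measurable_act t).comp (measurable_history π t t.isLt.le)

theorem measurable_roundObs (π : Policy A Z T) (t : Fin T) :
    Measurable fun ω : Outcomes A Z T => roundObs π ω t := by
  have := (measurable_pi_apply (Fin.last (t : ℕ))).comp (measurable_history π (t + 1) t.isLt)
  simp only [Function.comp_def, history_apply] at this
  exact this

instance (ν : Env A Z) : IsProbabilityMeasure (outcomeLaw ν T) := by
  unfold outcomeLaw; infer_instance

/-- Given the history, the outcome of the next round has the law of the action played. -/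
theorem lintegral_history_roundObs (ν : Env A Z) (π : Policy A Z T) (t : Fin T)
    {F : (Fin t → Obs A Z) → Obs A Z → ℝ≥0∞} (hF : Measurable (Function.uncurry F)) :
    ∫⁻ ω, F (history π ω t t.isLt.le) (roundObs π ω t) ∂outcomeLaw ν T
      = ∫⁻ ω, ∫⁻ x, F (history π ω t t.isLt.le) (playedAction π ω t, x)
          ∂(ν (playedAction π ω t) : Measure (Z × unitInterval)) ∂outcomeLaw ν T := by
  have hG : Measurable fun p : A × (Fin t → Obs A Z) =>
      ∫⁻ x, F p.2 (p.1, x) ∂(ν p.1 : Measure (Z × unitInterval)) :=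
    measurable_from_prod_countable_right fun a => by
      refine Measurable.lintegral_prod_right' (ν := (ν a : Measure (Z × unitInterval)))
        (f := fun q : (Fin t → Obs A Z) × (Z × unitInterval) => F q.1 (a, q.2)) ?_
      exact hF.comp (measurable_fst.prodMk (measurable_const.prodMk measurable_snd))
  have hh := measurable_history π t t.isLt.le
  have hupd : ∀ (ω : Outcomes A Z T) (y : A → Z × unitInterval),
      history π (Function.update ω t y) t t.isLt.le = history π ω t t.isLt.le := fun ω y =>
    history_congr π _ _ fun s hs => Function.update_of_ne (fun h => by simp [h] at hs) _ _
  have hact : ∀ (ω : Outcomes A Z T) (y : A → Z × unitInterval),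
      playedAction π (Function.update ω t y) t = playedAction π ω t := fun ω y => by
    simp only [playedAction, hupd]
  -- It suffices to compare the two integrands after integrating out row `t` alone. The history and
  -- the action are then constants, and only the coordinate of the action played is read.
  refine lintegral_eq_of_lmarginal_eq {t} ?_ ?_ ?_
  · exact hF.comp (hh.prodMk (measurable_roundObs π t))
  · exact hG.comp ((measurable_playedAction π t).prodMk hh)
  · ext1 ω
    rw [lmarginal_singleton, lmarginal_singleton]
    simp only [hupd, hact, roundObs, Function.update_self, lintegral_const, measure_univ, mul_one]
    have hmp := measurePreserving_eval
      (fun a : A => (ν a : Measure (Z × unitInterval))) (playedAction π ω t)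
    rw [← hmp.lintegral_comp (f := fun x => F (history π ω t t.isLt.le) (playedAction π ω t, x))
      (hF.comp (measurable_const.prodMk (measurable_const.prodMk measurable_id)))]

/-- A functional of the history that decreases on average in each round, whatever the action,
decreases on average. -/
theorem lintegral_history_le (ν : Env A Z) (π : Policy A Z T)
    {M : ∀ n : ℕ, (Fin n → Obs A Z) → ℝ≥0∞} (hM : ∀ n, Measurable (M n))
    (hstep : ∀ (n : ℕ) (h : Fin n → Obs A Z) (a : A),
      ∫⁻ x, M (n + 1) (Fin.snoc (α := fun _ => Obs A Z) h (a, x))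
        ∂(ν a : Measure (Z × unitInterval)) ≤ M n h) :
    ∀ (n : ℕ) (hn : n ≤ T), ∫⁻ ω, M n (history π ω n hn) ∂outcomeLaw ν T ≤ M 0 Fin.elim0
  | 0, _ => by simp [history]
  | n + 1, hn => by
    refine le_trans ?_ (lintegral_history_le ν π hM hstep n (Nat.le_of_succ_le hn))
    simp only [history_succ]
    rw [lintegral_history_roundObs ν π ⟨n, hn⟩
      (F := fun h o => M (n + 1) (Fin.snoc (α := fun _ => Obs A Z) h o))
      ((hM _).comp measurable_snoc)]
    exact lintegral_mono fun ω => hstep _ _ _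

/-- Ville's maximal inequality. -/
theorem measure_exists_le_history_le (ν : Env A Z) (π : Policy A Z T)
    {M : ∀ n : ℕ, (Fin n → Obs A Z) → ℝ≥0∞} (hM : ∀ n, Measurable (M n))
    (hstep : ∀ (n : ℕ) (h : Fin n → Obs A Z) (a : A),
      ∫⁻ x, M (n + 1) (Fin.snoc (α := fun _ => Obs A Z) h (a, x))
        ∂(ν a : Measure (Z × unitInterval)) ≤ M n h) (c : ℝ≥0∞) :
    c * outcomeLaw ν T {ω | ∃ (n : ℕ) (hn : n ≤ T), c ≤ M n (history π ω n hn)}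
      ≤ M 0 Fin.elim0 := by
  classical
  -- The process is frozen at the value `c` once the level is reached. It still decreases on
  -- average, and its terminal value is `c` wherever the level was ever reached, so Markov's
  -- inequality at time `T` suffices.
  set V : ∀ n : ℕ, (Fin n → Obs A Z) → ℝ≥0∞ := fun n h => if Reached M c n h then c else M n h
    with hV
  have hVm : ∀ n, Measurable (V n) := fun n =>
    Measurable.ite (measurableSet_reached hM c n) measurable_const (hM n)
  have hVstep : ∀ (n : ℕ) (h : Fin n → Obs A Z) (a : A),
      ∫⁻ x, V (n + 1) (Fin.snoc (α := fun _ => Obs A Z) h (a, x))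
        ∂(ν a : Measure (Z × unitInterval)) ≤ V n h := fun n h a => by
    by_cases hr : Reached M c n h
    · simp [hV, Reached, Fin.init_snoc, hr]
    · simp only [hV, Reached, Fin.init_snoc, hr, false_or, if_false]
      refine le_trans (lintegral_mono fun x => ?_) (hstep n h a)
      dsimp only
      split_ifs with h'
      · exact h'
      · exact le_rfl
  have hV0 : V 0 Fin.elim0 ≤ M 0 Fin.elim0 := by
    by_cases h' : c ≤ M 0 Fin.elim0 <;> simp [hV, Reached, h']
  refine le_trans ?_ ((lintegral_history_le ν π hVm hVstep T le_rfl).trans hV0)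
  have hm : MeasurableSet {ω : Outcomes A Z T | Reached M c T (history π ω T le_rfl)} :=
    measurable_history π T le_rfl (measurableSet_reached hM c T)
  calc _ ≤ c * outcomeLaw ν T {ω | Reached M c T (history π ω T le_rfl)} := by
        gcongr
        rintro ⟨n, hn, h⟩
        exact reached_history π _ hn h T le_rfl hn
    _ = ∫⁻ ω, ({ω | Reached M c T (history π ω T le_rfl)} : Set (Outcomes A Z T)).indicator
          (fun _ => c) ω ∂outcomeLaw ν T := by
        rw [lintegral_indicator hm, setLIntegral_const]
    _ ≤ _ := by
        refine lintegral_mono fun ω => ?_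
        by_cases hr : Reached M c T (history π ω T le_rfl)
        · simp [hV, hr]
        · simp [hr]

end Resampling

/-! ### Concentration along the history -/

section Concentration

/-- Hoeffding's lemma for the measure conditioned on `s`, where a variable in `[0, 1]` has variance
proxy `1/4`; off `s` the integrand is 1. A null `s` leaves `m` unconstrained. -/
theorem lintegral_exp_cond_mean_le_one {X : Type*} [MeasurableSpace X] (ρ : Measure X)
    [IsProbabilityMeasure ρ] {s : Set X} [DecidablePred (· ∈ s)] (hs : MeasurableSet s)
    {g : X → ℝ} (hg : Measurable g) (hg01 : ∀ x, g x ∈ Set.Icc (0 : ℝ) 1) {m : ℝ}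
    (hm : ρ s ≠ 0 → ∫ x, g x ∂(cond ρ s) = m) (l : ℝ) :
    ∫⁻ x, ENNReal.ofReal (if x ∈ s then Real.exp (l * (g x - m) - l ^ 2 / 8) else 1) ∂ρ ≤ 1 := by
  rw [← lintegral_add_compl _ hs]
  have h2 : ∫⁻ x in sᶜ, ENNReal.ofReal
      (if x ∈ s then Real.exp (l * (g x - m) - l ^ 2 / 8) else 1) ∂ρ = ρ sᶜ := by
    rw [setLIntegral_congr_fun hs.compl (g := fun _ => 1) fun x hx => by
      simp [show x ∉ s from hx]]
    simp
  have h1 : ∫⁻ x in s, ENNReal.ofReal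
      (if x ∈ s then Real.exp (l * (g x - m) - l ^ 2 / 8) else 1) ∂ρ ≤ ρ s := by
    rw [setLIntegral_congr_fun hs
      (g := fun x => ENNReal.ofReal (Real.exp (l * (g x - m) - l ^ 2 / 8))) fun x hx => by simp [hx]]
    by_cases h0 : ρ s = 0
    · rw [setLIntegral_measure_zero _ _ h0]; exact zero_le
    have hc := cond_isProbabilityMeasure (μ := ρ) h0
    have hres : ρ.restrict s = ρ s • cond ρ s := by
      rw [ProbabilityTheory.cond, smul_smul, ENNReal.mul_inv_cancel h0 (measure_ne_top _ _), one_smul]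
    have hsub := hasSubgaussianMGF_of_mem_Icc (μ := cond ρ s) hg.aemeasurable
      (Filter.Eventually.of_forall hg01)
    rw [hm h0] at hsub
    have hle := hsub.mgf_le l
    rw [hres, lintegral_smul_measure, smul_eq_mul]
    refine mul_le_of_le_one_right' ?_
    have hexp : ∀ x, Real.exp (l * (g x - m) - l ^ 2 / 8)
        = Real.exp (-(l ^ 2 / 8)) * Real.exp (l * (g x - m)) := fun x => by
      rw [← Real.exp_add]; ring_nf
    simp only [hexp]
    rw [← ofReal_integral_eq_lintegral_ofReal ((hsub.integrable_exp_mul l).const_mul _)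
      (Filter.Eventually.of_forall fun x => by positivity), integral_const_mul,
      ← ENNReal.ofReal_one]
    refine ENNReal.ofReal_le_ofReal ?_
    have : Real.exp (-(l ^ 2 / 8)) * Real.exp (l ^ 2 / 8) = 1 := by
      rw [← Real.exp_add]; simp
    rw [← this]
    gcongr
    refine hle.trans (Real.exp_le_exp.mpr ?_)
    norm_num
    linarith
  calc _ ≤ ρ s + ρ sᶜ := by rw [h2]; gcongr
    _ = 1 := by rw [measure_add_measure_compl hs, measure_univ]

variable {A Z : Type*}

/-- The number of rounds whose observation satisfies `P`. -/
def visits (P : Obs A Z → Prop) [DecidablePred P] {n : ℕ} (h : Fin n → Obs A Z) : ℕ :=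
  ∑ s, if P (h s) then 1 else 0

/-- The sum of `g - m` over the rounds whose observation satisfies `P`. -/
noncomputable def deviation (P : Obs A Z → Prop) [DecidablePred P] (g : Obs A Z → ℝ) (m : ℝ)
    {n : ℕ} (h : Fin n → Obs A Z) : ℝ :=
  ∑ s, if P (h s) then g (h s) - m else 0

theorem visits_le (P : Obs A Z → Prop) [DecidablePred P] {n : ℕ} (h : Fin n → Obs A Z) :
    visits P h ≤ n := by
  refine (Finset.sum_le_card_nsmul _ _ 1 fun s _ => ?_).trans (by simp)
  split_ifs <;> simp

theorem visits_snoc (P : Obs A Z → Prop) [DecidablePred P] {n : ℕ} (h : Fin n → Obs A Z)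
    (o : Obs A Z) : visits P (Fin.snoc (α := fun _ => Obs A Z) h o : Fin (n + 1) → Obs A Z)
      = visits P h + if P o then 1 else 0 := by
  rw [visits, Fin.sum_univ_castSucc]
  simp only [Fin.snoc_castSucc, Fin.snoc_last]
  rfl

theorem deviation_snoc (P : Obs A Z → Prop) [DecidablePred P] (g : Obs A Z → ℝ) (m : ℝ) {n : ℕ}
    (h : Fin n → Obs A Z) (o : Obs A Z) :
    deviation P g m (Fin.snoc (α := fun _ => Obs A Z) h o : Fin (n + 1) → Obs A Z)
      = deviation P g m h + if P o then g o - m else 0 := by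
  simp [deviation, Fin.sum_univ_castSucc]

theorem deviation_eq (P : Obs A Z → Prop) [DecidablePred P] (g : Obs A Z → ℝ) (m : ℝ) {n : ℕ}
    (h : Fin n → Obs A Z) :
    deviation P g m h = (∑ s, if P (h s) then g (h s) else 0) - visits P h * m := by
  rw [deviation, visits, Nat.cast_sum, Finset.sum_mul, ← Finset.sum_sub_distrib]
  refine Finset.sum_congr rfl fun s _ => ?_
  split_ifs <;> simp

/-- The reflection `g ↦ 1 - g` keeps values in `[0, 1]`, so the lower tail follows from the upper
one. -/
theorem deviation_one_sub (P : Obs A Z → Prop) [DecidablePred P] (g : Obs A Z → ℝ) (m : ℝ) {n : ℕ}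
    (h : Fin n → Obs A Z) :
    deviation P (fun o => 1 - g o) (1 - m) h = - deviation P g m h := by
  rw [deviation, deviation, ← Finset.sum_neg_distrib]
  refine Finset.sum_congr rfl fun s _ => ?_
  split_ifs <;> ring

variable [MeasurableSpace A] [MeasurableSpace Z]

theorem measurable_visits {P : Obs A Z → Prop} [DecidablePred P] (hP : MeasurableSet {o | P o})
    {n : ℕ} : Measurable fun h : Fin n → Obs A Z => visits P h :=
  Finset.measurable_sum _ fun s _ =>
    (Measurable.ite hP measurable_const measurable_const).comp (measurable_pi_apply s)

variable [Fintype A] [DiscreteMeasurableSpace A] {T : ℕ}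

/-- Ville's inequality for `exp (l * deviation - l ^ 2 / 8 * visits)`. Since `m` does not depend on
the action, the supermartingale property holds whatever the policy plays. Fixing the number of
visits, rather than the time, allows one optimal `l`. -/
theorem measure_le_deviation_le (ν : Env A Z) (π : Policy A Z T) {P : Obs A Z → Prop}
    [DecidablePred P] (hP : MeasurableSet {o | P o}) {g : Obs A Z → ℝ} (hg : Measurable g)
    (hg01 : ∀ o, g o ∈ Set.Icc (0 : ℝ) 1) {m : ℝ}
    (hm : ∀ a, (ν a : Measure (Z × unitInterval)) {x | P (a, x)} ≠ 0 →
      ∫ x, g (a, x) ∂(cond (ν a : Measure (Z × unitInterval)) {x | P (a, x)}) = m)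
    {k : ℕ} (hk : 0 < k) {d : ℝ} (hd : 0 ≤ d) :
    outcomeLaw ν T {ω | ∃ (n : ℕ) (hn : n ≤ T), visits P (history π ω n hn) = k ∧
        d ≤ deviation P g m (history π ω n hn)}
      ≤ ENNReal.ofReal (Real.exp (-2 * d ^ 2 / k)) := by
  have hk' : (0 : ℝ) < k := Nat.cast_pos.mpr hk
  -- The maximizer of `l * d - l ^ 2 / 8 * k`, with maximum `2 * d ^ 2 / k`.
  set l : ℝ := 4 * d / k with hl
  set M : ∀ n : ℕ, (Fin n → Obs A Z) → ENNReal := fun n h =>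
    ENNReal.ofReal (Real.exp (l * deviation P g m h - l ^ 2 / 8 * visits P h)) with hMdef
  have hM : ∀ n, Measurable (M n) := fun n => by
    have h1 : Measurable fun h : Fin n → Obs A Z => deviation P g m h :=
      measurable_sum_ite hP (hg.sub_const m)
    have h2 : Measurable fun h : Fin n → Obs A Z => (visits P h : ℝ) :=
      measurable_from_nat.comp (measurable_visits hP)
    exact ((h1.const_mul _).sub (h2.const_mul _)).exp.ennreal_ofReal
  have hstep : ∀ (n : ℕ) (h : Fin n → Obs A Z) (a : A),
      ∫⁻ x, M (n + 1) (Fin.snoc (α := fun _ => Obs A Z) h (a, x))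
        ∂(ν a : Measure (Z × unitInterval)) ≤ M n h := fun n h a => by
    have hmul : ∀ x : Z × unitInterval, M (n + 1) (Fin.snoc (α := fun _ => Obs A Z) h (a, x))
        = M n h * ENNReal.ofReal (if x ∈ {x : Z × unitInterval | P (a, x)} then
            Real.exp (l * (g (a, x) - m) - l ^ 2 / 8) else 1) := fun x => by
      simp only [hMdef, visits_snoc, deviation_snoc]
      rw [← ENNReal.ofReal_mul (Real.exp_pos _).le]
      by_cases hx : P (a, x)
      · simp only [hx, if_true, Set.mem_ofPred_eq]
        rw [← Real.exp_add]
        push_cast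
        ring_nf
      · simp [hx]
    simp only [hmul]
    have hmeas : Measurable fun x : Z × unitInterval => ((a, x) : Obs A Z) :=
      measurable_const.prodMk measurable_id
    have hsP : MeasurableSet {x : Z × unitInterval | P (a, x)} := hmeas hP
    rw [lintegral_const_mul]
    · refine mul_le_of_le_one_right' ?_
      exact lintegral_exp_cond_mean_le_one _ hsP (hg.comp hmeas) (fun x => hg01 _) (hm a) l
    · refine (Measurable.ite hsP ?_ measurable_const).ennreal_ofReal
      exact ((((hg.comp hmeas).sub_const m).const_mul l).sub_const _).exp
  have hV := measure_exists_le_history_le ν π hM hstep (ENNReal.ofReal (Real.exp (2 * d ^ 2 / k)))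
  have hM0 : M 0 Fin.elim0 = 1 := by simp [hMdef, deviation, visits]
  rw [hM0] at hV
  have hinv : ENNReal.ofReal (Real.exp (-2 * d ^ 2 / k))
      = (ENNReal.ofReal (Real.exp (2 * d ^ 2 / k)))⁻¹ := by
    rw [← ENNReal.ofReal_inv_of_pos (Real.exp_pos _), ← Real.exp_neg]
    ring_nf
  rw [hinv, ENNReal.le_inv_iff_mul_le, mul_comm]
  refine le_trans (mul_le_mul' le_rfl (measure_mono ?_)) hV
  rintro ω ⟨n, hn, hv, hdev⟩
  refine ⟨n, hn, ?_⟩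
  simp only [hMdef, hv]
  refine ENNReal.ofReal_le_ofReal (Real.exp_le_exp.mpr ?_)
  have hl0 : 0 ≤ l := by positivity
  have : l * d - l ^ 2 / 8 * k = 2 * d ^ 2 / k := by
    rw [hl]; field_simp; ring
  nlinarith [mul_le_mul_of_nonneg_left hdev hl0]

theorem measure_le_abs_deviation_le (ν : Env A Z) (π : Policy A Z T) {P : Obs A Z → Prop}
    [DecidablePred P] (hP : MeasurableSet {o | P o}) {g : Obs A Z → ℝ} (hg : Measurable g)
    (hg01 : ∀ o, g o ∈ Set.Icc (0 : ℝ) 1) {m : ℝ}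
    (hm : ∀ a, (ν a : Measure (Z × unitInterval)) {x | P (a, x)} ≠ 0 →
      ∫ x, g (a, x) ∂(cond (ν a : Measure (Z × unitInterval)) {x | P (a, x)}) = m)
    {k : ℕ} (hk : 0 < k) {d : ℝ} (hd : 0 ≤ d) :
    outcomeLaw ν T {ω | ∃ (n : ℕ) (hn : n ≤ T), visits P (history π ω n hn) = k ∧
        d ≤ |deviation P g m (history π ω n hn)|}
      ≤ 2 * ENNReal.ofReal (Real.exp (-2 * d ^ 2 / k)) := by
  have h1 := measure_le_deviation_le ν π hP hg hg01 hm hk hd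
  have h2 := measure_le_deviation_le ν π hP (g := fun o => 1 - g o) (hg.const_sub 1)
    (fun o => ⟨by linarith [(hg01 o).2], by linarith [(hg01 o).1]⟩) (m := 1 - m)
    (fun a ha => by
      have := cond_isProbabilityMeasure ha
      have hga : Measurable fun x : Z × unitInterval => g (a, x) :=
        hg.comp (measurable_const.prodMk measurable_id)
      rw [integral_sub (integrable_const _) (Integrable.of_mem_Icc 0 1 hga.aemeasurable
        (Filter.Eventually.of_forall fun x => hg01 (a, x))), hm a ha]
      simp) hk hd
  rw [two_mul]
  refine le_trans (measure_mono ?_) ((measure_union_le _ _).trans (add_le_add h1 h2))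
  rintro ω ⟨n, hn, hv, hdev⟩
  rcases le_abs.mp hdev with h | h
  · exact Or.inl ⟨n, hn, hv, h⟩
  · exact Or.inr ⟨n, hn, hv, by rwa [deviation_one_sub]⟩

/-- The empirical mean of `g` over the rounds satisfying `P` is at all times within the confidence
radius of the conditional mean of `g` given `P`, up to probability `2 / T`. -/
theorem measure_not_mem_confidence_le (ν : Env A Z) (π : Policy A Z T) (hT : 3 ≤ T)
    {P : Obs A Z → Prop} [DecidablePred P] (hP : MeasurableSet {o | P o}) {g : Obs A Z → ℝ}
    (hg : Measurable g) (hg01 : ∀ o, g o ∈ Set.Icc (0 : ℝ) 1) {m : ℝ}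
    (hm01 : m ∈ Set.Icc (0 : ℝ) 1)
    (hm : ∀ a, (ν a : Measure (Z × unitInterval)) {x | P (a, x)} ≠ 0 →
      ∫ x, g (a, x) ∂(cond (ν a : Measure (Z × unitInterval)) {x | P (a, x)}) = m) :
    outcomeLaw ν T {ω | ∃ (n : ℕ) (hn : n ≤ T),
        √(Real.log T / max 1 (visits P (history π ω n hn) : ℝ))
          < |(max 1 (visits P (history π ω n hn) : ℝ))⁻¹
              * (∑ s, if P (history π ω n hn s) then g (history π ω n hn s) else 0) - m|}
      ≤ ENNReal.ofReal (2 / T) := by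
  have hT0 : (0 : ℝ) < T := by positivity
  have hL : 1 ≤ Real.log T := by
    rw [Real.le_log_iff_exp_le hT0]
    have : (3 : ℝ) ≤ T := by exact_mod_cast hT
    linarith [Real.exp_one_lt_d9]
  -- Union bound over the number of visits. The deviation `√(k * log T)` makes each term `2 / T ^
  -- 2`, and there are `T` of them.
  have hk : ∀ k ∈ Finset.Icc 1 T, outcomeLaw ν T {ω | ∃ (n : ℕ) (hn : n ≤ T),
      visits P (history π ω n hn) = k ∧
        √(k * Real.log T) ≤ |deviation P g m (history π ω n hn)|}
      ≤ ENNReal.ofReal (2 / (T : ℝ) ^ 2) := fun k hk => by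
    have hk1 := (Finset.mem_Icc.mp hk).1
    have hk0 : (0 : ℝ) < k := Nat.cast_pos.mpr hk1
    refine (measure_le_abs_deviation_le ν π hP hg hg01 hm hk1 (Real.sqrt_nonneg _)).trans ?_
    rw [Real.sq_sqrt (by positivity),
      show -2 * (k * Real.log T) / k = -(2 * Real.log T) by field_simp, Real.exp_neg,
      mul_comm 2 (Real.log T), Real.exp_mul, Real.exp_log hT0,
      show (2 : ENNReal) = ENNReal.ofReal 2 by simp, ← ENNReal.ofReal_mul (by norm_num)]
    simp [div_eq_mul_inv]
  have hsub : {ω | ∃ (n : ℕ) (hn : n ≤ T),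
        √(Real.log T / max 1 (visits P (history π ω n hn) : ℝ))
          < |(max 1 (visits P (history π ω n hn) : ℝ))⁻¹
              * (∑ s, if P (history π ω n hn s) then g (history π ω n hn s) else 0) - m|}
      ⊆ ⋃ k ∈ Finset.Icc 1 T, {ω | ∃ (n : ℕ) (hn : n ≤ T),
      visits P (history π ω n hn) = k ∧
        √(k * Real.log T) ≤ |deviation P g m (history π ω n hn)|} := by
    rintro ω ⟨n, hn, hlt⟩
    set h := history π ω n hn with hh
    simp only [Set.mem_iUnion]
    have hdev := deviation_eq P g m h
    rcases Nat.eq_zero_or_pos (visits P h) with h0 | hpos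
    -- Without visits the empirical mean is 0 and the count is 1 by convention; the radius `√(log T)
    -- ≥ 1` then covers any `m` in `[0, 1]`.
    · exfalso
      have hs : (∑ s, if P (h s) then g (h s) else 0) = 0 := by
        refine Finset.sum_eq_zero fun s hs => if_neg fun hPs => ?_
        have := (Finset.sum_eq_zero_iff.mp h0) s hs
        simp [hPs] at this
      rw [hs, h0] at hlt
      simp only [Nat.cast_zero, mul_zero, zero_sub, abs_neg, abs_of_nonneg hm01.1] at hlt
      have : 1 ≤ √(Real.log T / max 1 (0 : ℝ)) := by
        rw [Real.one_le_sqrt]; simpa using hL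
      linarith [hm01.2]
    · have hv1 : (1 : ℝ) ≤ visits P h := by exact_mod_cast hpos
      have hv0 : (0 : ℝ) < visits P h := by linarith
      refine ⟨visits P h, Finset.mem_Icc.mpr ⟨hpos, (visits_le P h).trans hn⟩, n, hn, rfl, ?_⟩
      rw [max_eq_right hv1] at hlt
      have he : (visits P h : ℝ)⁻¹ * (∑ s, if P (h s) then g (h s) else 0) - m
          = (visits P h : ℝ)⁻¹ * deviation P g m h := by
        rw [hdev]; field_simp
      rw [he, abs_mul, abs_of_pos (inv_pos.mpr hv0)] at hlt
      have hsq : √(visits P h * Real.log T)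
          = visits P h * √(Real.log T / visits P h) := by
        rw [show (visits P h : ℝ) * Real.log T
          = (visits P h : ℝ) ^ 2 * (Real.log T / visits P h) by field_simp,
          Real.sqrt_mul (by positivity), Real.sqrt_sq hv0.le]
      rw [← hh, hsq]
      calc _ ≤ (visits P h : ℝ) * ((visits P h : ℝ)⁻¹ * |deviation P g m h|) := by gcongr
        _ = _ := by field_simp
  refine (measure_mono hsub).trans ((measure_biUnion_finset_le _ _).trans
    ((Finset.sum_le_sum hk).trans ?_))
  rw [Finset.sum_const, Nat.card_Icc, nsmul_eq_mul, Nat.add_sub_cancel,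
    ← ENNReal.ofReal_natCast, ← ENNReal.ofReal_mul hT0.le]
  refine ENNReal.ofReal_le_ofReal (le_of_eq ?_)
  field_simp

end Concentration

/-! ### Counting -/

section Counting

theorem sum_ite_lt_and {X : Type*} {k n : ℕ} (hk : k ≤ n) (h : Fin n → X) (Q : X → Prop)
    [DecidablePred Q] :
    (∑ s : Fin n, if (s : ℕ) < k ∧ Q (h s) then (1 : ℝ) else 0)
      = ∑ s : Fin k, if Q (h (s.castLE hk)) then 1 else 0 := by
  obtain ⟨j, rfl⟩ := Nat.exists_eq_add_of_le hk
  rw [Fin.sum_univ_add]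
  have h2 : ∀ s : Fin j, ¬ (((Fin.natAdd k s : Fin (k + j)) : ℕ) < k) := fun s => by simp
  simp only [h2, false_and, if_false, Finset.sum_const_zero, add_zero]
  refine Finset.sum_congr rfl fun s _ => ?_
  have : ((Fin.castAdd j s : Fin (k + j)) : ℕ) < k := s.isLt
  simp only [this, true_and]
  rfl

theorem sum_ite_div_eq {K m i : ℕ} (hi : i < K) (hm : 0 < m) :
    (∑ s : Fin (K * m), if (s : ℕ) / m = i then 1 else 0) = m := by
  rw [Fin.sum_univ_eq_sum_range (fun s => if s / m = i then 1 else 0), Finset.sum_boole]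
  have : (Finset.range (K * m)).filter (fun s => s / m = i) = Finset.Ico (i * m) ((i + 1) * m) := by
    ext s
    rw [Finset.mem_filter, Finset.mem_range, Finset.mem_Ico, and_iff_right_of_imp]
    · rw [← Nat.le_div_iff_mul_le hm, ← Nat.div_lt_iff_lt_mul hm]
      omega
    · rintro rfl
      exact (Nat.div_lt_iff_lt_mul hm).mp hi
  rw [this]
  simp [Nat.add_mul]

/-- For `N ≥ 1` the increment of the root is `1 / (√(N + 1) + √N)`, and `√(N + 1) ≤ 2 * √N`, whence
the constant 3. It also absorbs `N = 0`, where the count is replaced by 1. -/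
theorem three_sqrt_add_inv_sqrt_le {N : ℕ} :
    3 * √(N : ℝ) + (√(max 1 (N : ℝ)))⁻¹ ≤ 3 * √((N : ℝ) + 1) := by
  rcases Nat.eq_zero_or_pos N with rfl | hN
  · norm_num
  have h1 : (1 : ℝ) ≤ N := by exact_mod_cast hN
  rw [max_eq_right h1]
  have hx : 1 ≤ √(N : ℝ) := Real.one_le_sqrt.mpr h1
  have hy := Real.sqrt_nonneg ((N : ℝ) + 1)
  have hx2 : √(N : ℝ) ^ 2 = N := Real.sq_sqrt (by positivity)
  have hy2 : √((N : ℝ) + 1) ^ 2 = N + 1 := Real.sq_sqrt (by positivity)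
  set x := √(N : ℝ)
  set y := √((N : ℝ) + 1)
  have hy2x : y ≤ 2 * x := by nlinarith
  have hxy : x ≤ y := by nlinarith
  rw [← le_sub_iff_add_le', inv_le_iff_one_le_mul₀ (by linarith)]
  nlinarith

theorem sum_ite_inv_sqrt_count_le {ι : Type*} [DecidableEq ι] (i : ι) : ∀ {n : ℕ} (o : Fin n → ι),
    (∑ t : Fin n, if o t = i then
        (√(max 1 (∑ s : Fin t, if o (s.castLE t.isLt.le) = i then (1 : ℝ) else 0)))⁻¹ else 0)
      ≤ 3 * √(∑ s, if o s = i then (1 : ℝ) else 0)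
  | 0, _ => by simp
  | n + 1, o => by
    have ih := sum_ite_inv_sqrt_count_le i fun s : Fin n => o s.castSucc
    rw [Fin.sum_univ_castSucc, Fin.sum_univ_castSucc (n := n)]
    by_cases hl : o (Fin.last n) = i
    · simp only [hl, if_true]
      have hN := three_sqrt_add_inv_sqrt_le (N := ∑ s : Fin n, if o s.castSucc = i then 1 else 0)
      push_cast at hN
      exact (add_le_add_left ih _).trans hN
    · simp only [hl, if_false, add_zero]
      exact ih

/-- Grouping the rounds by the value of `o` leaves one telescoping sum per value; Cauchy–Schwarz
combines them, because the final counts add up to `n`. -/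
theorem sum_inv_sqrt_count_le {ι : Type*} [Fintype ι] [DecidableEq ι] {n : ℕ} (o : Fin n → ι) :
    (∑ t : Fin n,
        (√(max 1 (∑ s : Fin t, if o (s.castLE t.isLt.le) = o t then (1 : ℝ) else 0)))⁻¹)
      ≤ 3 * √(Fintype.card ι * n) := by
  set c : ι → ℝ := fun i => ∑ s, if o s = i then (1 : ℝ) else 0 with hc
  have hc0 : ∀ i, 0 ≤ c i := fun i => Finset.sum_nonneg fun s _ => by split_ifs <;> norm_num
  have hsum : ∑ i, c i = n := by
    simp only [hc]
    rw [Finset.sum_comm]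
    simp
  calc _ = ∑ i, ∑ t : Fin n, if o t = i then
        (√(max 1 (∑ s : Fin t, if o (s.castLE t.isLt.le) = i then (1 : ℝ) else 0)))⁻¹ else 0 := by
        rw [Finset.sum_comm]
        refine Finset.sum_congr rfl fun t _ => ?_
        rw [Finset.sum_ite_eq]
        simp
    _ ≤ ∑ i, 3 * √(c i) := Finset.sum_le_sum fun i _ => sum_ite_inv_sqrt_count_le i o
    _ = 3 * ∑ i, √(c i) := by rw [Finset.mul_sum]
    _ ≤ _ := by
        gcongr
        refine Real.le_sqrt_of_sq_le ?_
        refine sq_sum_le_card_mul_sum_sq.trans ?_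
        rw [Finset.card_univ]
        simp only [Real.sq_sqrt (hc0 _), hsum, le_refl]

/-- Positive and negative parts have equal mass. An `ℓ¹` distance of distributions thereby becomes
twice the deviation of a single event. -/
theorem sum_abs_eq_two_mul_sum_filter {ι : Type*} [Fintype ι] {x : ι → ℝ} (hx : ∑ i, x i = 0) :
    ∑ i, |x i| = 2 * ∑ i with 0 ≤ x i, x i := by
  have h := Finset.sum_filter_add_sum_filter_not Finset.univ (fun i => 0 ≤ x i) x
  have h' := Finset.sum_filter_add_sum_filter_not Finset.univ (fun i => 0 ≤ x i) fun i => |x i|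
  have h1 : ∑ i with 0 ≤ x i, |x i| = ∑ i with 0 ≤ x i, x i :=
    Finset.sum_congr rfl fun i hi => abs_of_nonneg (Finset.mem_filter.mp hi).2
  have h2 : ∑ i with ¬ 0 ≤ x i, |x i| = - ∑ i with ¬ 0 ≤ x i, x i := by
    rw [← Finset.sum_neg_distrib]
    exact Finset.sum_congr rfl fun i hi =>
      abs_of_neg (not_le.mp (Finset.mem_filter.mp hi).2)
  linarith

end Counting

/-! ### Statistics of the history -/

section History

variable {A Z : Type*} {n : ℕ}

theorem actionCount_eq [DecidableEq A] (h : Fin n → Obs A Z) (a : A) :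
    actionCount h a = max 1 (visits (fun o => o.1 = a) h : ℝ) := by
  simp [actionCount, visits]

theorem contextCount_eq [DecidableEq Z] (h : Fin n → Obs A Z) (z : Z) :
    contextCount h z = max 1 (visits (fun o => o.2.1 = z) h : ℝ) := by
  simp [contextCount, visits]

theorem one_le_contextCount [DecidableEq Z] (h : Fin n → Obs A Z) (z : Z) :
    1 ≤ contextCount h z := le_max_left _ _

theorem visits_castLE_le (P : Obs A Z → Prop) [DecidablePred P] {k : ℕ} (hk : k ≤ n)
    (h : Fin n → Obs A Z) : visits P (fun s : Fin k => h (s.castLE hk)) ≤ visits P h := by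
  obtain ⟨j, rfl⟩ := Nat.exists_eq_add_of_le hk
  rw [visits, visits, Fin.sum_univ_add]
  exact Nat.le_add_right _ _

section Sums

variable [MeasurableSpace A] [MeasurableSpace Z] {T : ℕ}

theorem sum_inv_sqrt_actionCount_le [Fintype A] [DecidableEq A] (π : Policy A Z T)
    (ω : Outcomes A Z T) :
    ∑ t : Fin T, (√(actionCount (history π ω t t.isLt.le) (playedAction π ω t)))⁻¹
      ≤ 3 * √(Fintype.card A * T) := by
  have := sum_inv_sqrt_count_le fun t => playedAction π ω t
  simp only [actionCount, history_apply]
  exact this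

theorem sum_inv_sqrt_contextCount_le [Fintype Z] [DecidableEq Z] (π : Policy A Z T)
    (ω : Outcomes A Z T) :
    ∑ t : Fin T, (√(contextCount (history π ω t t.isLt.le) (roundObs π ω t).2.1))⁻¹
      ≤ 3 * √(Fintype.card Z * T) := by
  have := sum_inv_sqrt_count_le fun t => (roundObs π ω t).2.1
  simp only [contextCount, history_apply]
  exact this

end Sums

variable [Fintype A] [LinearOrder A] [DecidableEq Z]

/-- The estimate reads only the rounds of the first phase, so it stays frozen afterwards. -/
theorem mle_castLE (T : ℕ) (hn : Fintype.card A * explore₁ A T ≤ n) (h : Fin n → Obs A Z) :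
    mle T h = mle T fun s : Fin (Fintype.card A * explore₁ A T) => h (s.castLE hn) := by
  ext a z
  rw [mle, mle]
  simp only [Fin.is_lt, true_and]
  rw [sum_ite_lt_and hn h fun o => o.1 = a ∧ o.2.1 = z, sum_ite_lt_and hn h fun o => o.1 = a]

/-- This puts the empirical mass of `B` in the form of the sum in `deviation_eq`, with the indicator
of `B` as `g`. -/
theorem sum_mle_mul (T : ℕ) (h : Fin (Fintype.card A * explore₁ A T) → Obs A Z) (a : A)
    (hv : visits (fun o => o.1 = a) h ≠ 0) (B : Finset Z) :
    (∑ z ∈ B, mle T h a z) * visits (fun o => o.1 = a) h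
      = ∑ s, if (h s).1 = a then (if (h s).2.1 ∈ B then (1 : ℝ) else 0) else 0 := by
  have hden : (∑ s : Fin (Fintype.card A * explore₁ A T), if
      (s : ℕ) < Fintype.card A * explore₁ A T ∧ (h s).1 = a then (1 : ℝ) else 0)
      = visits (fun o => o.1 = a) h := by
    simp [visits]
  simp only [mle, hden]
  rw [← Finset.sum_div, div_mul_cancel₀ _ (Nat.cast_ne_zero.mpr hv), Finset.sum_comm]
  refine Finset.sum_congr rfl fun s _ => ?_
  simp only [Fin.is_lt, true_and]
  by_cases ha : (h s).1 = a <;> simp [ha]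

variable [Fintype Z]

theorem sum_mle (T : ℕ) (h : Fin (Fintype.card A * explore₁ A T) → Obs A Z) (a : A)
    (hv : visits (fun o => o.1 = a) h ≠ 0) : ∑ z, mle T h a z = 1 := by
  have := sum_mle_mul T h a hv Finset.univ
  have hv' : (visits (fun o => o.1 = a) h : ℝ) ≠ 0 := Nat.cast_ne_zero.mpr hv
  refine mul_right_cancel₀ hv' (this.trans ?_)
  simp [visits]

variable [Nonempty A] [MeasurableSpace A] [DiscreteMeasurableSpace A] [MeasurableSpace Z]
  [DiscreteMeasurableSpace Z] {T : ℕ}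

/-- The first exploration phase plays each action equally often. -/
theorem visits_explore₁ (q : A → ProbabilityMeasure Z) (ω : Outcomes A Z T)
    (hn : Fintype.card A * explore₁ A T ≤ T) (h0 : 0 < explore₁ A T) (a : A) :
    visits (fun o => o.1 = a) (history (hacUCB T q) ω _ hn) = explore₁ A T := by
  set e := Fintype.orderIsoFinOfCardEq A rfl
  have hi := (e.symm a).isLt
  refine Eq.trans ?_ (sum_ite_div_eq hi h0)
  refine Finset.sum_congr rfl fun s _ => if_congr ?_ rfl rfl
  rw [history_apply]
  change hacAct T _ (s : ℕ) _ = a ↔ _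
  rw [hacAct, dif_pos s.isLt]
  rw [← OrderIso.eq_symm_apply, Fin.ext_iff]

end History

/-! ### From a bound on the rounds to a bound on the regret -/

section RegretBound

theorem inv_sqrt_contextCount_mem_Icc {A Z : Type*} [DecidableEq Z] {n : ℕ} (h : Fin n → Obs A Z)
    (z : Z) : (√(contextCount h z))⁻¹ ∈ Set.Icc (0 : ℝ) 1 :=
  ⟨by positivity, inv_le_one_of_one_le₀ (Real.one_le_sqrt.mpr (one_le_contextCount h z))⟩

variable {A Z : Type*} [MeasurableSpace Z]

theorem meanReward_mem_Icc (ν : Env A Z) (a : A) : meanReward ν a ∈ Set.Icc (0 : ℝ) 1 := by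
  have hi : Integrable (fun x : Z × unitInterval => (x.2 : ℝ))
      (ν a : Measure (Z × unitInterval)) :=
    Integrable.of_mem_Icc 0 1 (measurable_subtype_coe.comp measurable_snd).aemeasurable
      (Filter.Eventually.of_forall fun x => x.2.2)
  refine ⟨integral_nonneg fun x => x.2.2.1, ?_⟩
  refine (integral_mono hi (integrable_const 1) fun x => x.2.2.2).trans ?_
  simp

theorem contextProb_nonneg (ν : Env A Z) (a : A) (z : Z) : 0 ≤ contextProb ν a z :=
  measureReal_nonneg

variable [Fintype Z] [DiscreteMeasurableSpace Z]

theorem lintegral_context (ν : Env A Z) (a : A) {f : Z → ℝ} (hf : ∀ z, 0 ≤ f z) :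
    ∫⁻ x, ENNReal.ofReal (f x.1) ∂(ν a : Measure (Z × unitInterval))
      = ENNReal.ofReal (∑ z, f z * contextProb ν a z) := by
  rw [← lintegral_map (f := fun z => ENNReal.ofReal (f z)) (μ := (ν a : Measure (Z × unitInterval)))
    .of_discrete measurable_fst, lintegral_fintype,
    ENNReal.ofReal_sum_of_nonneg fun z _ => mul_nonneg (hf z) (contextProb_nonneg ν a z)]
  refine Finset.sum_congr rfl fun z _ => ?_
  rw [ENNReal.ofReal_mul (hf z), Measure.map_apply measurable_fst (measurableSet_singleton z),
    contextProb, ofReal_measureReal]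

theorem sum_contextProb (ν : Env A Z) (a : A) : ∑ z, contextProb ν a z = 1 := by
  have := lintegral_context ν a (f := fun _ => 1) fun _ => zero_le_one
  simp only [ENNReal.ofReal_one, lintegral_const, measure_univ, mul_one, one_mul] at this
  have h := congrArg ENNReal.toReal this
  rw [ENNReal.toReal_ofReal (Finset.sum_nonneg fun z _ => contextProb_nonneg ν a z)] at h
  simpa using h.symm

variable [MeasurableSpace A] [DecidableEq Z] {T : ℕ}

theorem measurable_contextCount_uncurry {n : ℕ} :
    Measurable fun p : (Fin n → Obs A Z) × Z => contextCount p.1 p.2 :=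
  measurable_from_prod_countable_left fun z => measurable_contextCount z

/-- The expectation of `1 / √N(z)` under the law of the context given the action played. -/
noncomputable def contextWidth (ν : Env A Z) (π : Policy A Z T) (t : Fin T) (ω : Outcomes A Z T) :
    ℝ :=
  ∑ z, (√(contextCount (history π ω t t.isLt.le) z))⁻¹ * contextProb ν (playedAction π ω t) z

theorem contextWidth_mem_Icc (ν : Env A Z) (π : Policy A Z T) (t : Fin T) (ω : Outcomes A Z T) :
    contextWidth ν π t ω ∈ Set.Icc (0 : ℝ) 1 := by
  refine ⟨Finset.sum_nonneg fun z _ => mul_nonneg (inv_sqrt_contextCount_mem_Icc _ z).1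
    (contextProb_nonneg _ _ _), ?_⟩
  rw [← sum_contextProb ν (playedAction π ω t)]
  exact Finset.sum_le_sum fun z _ => mul_le_of_le_one_left (contextProb_nonneg _ _ _)
    (inv_sqrt_contextCount_mem_Icc _ z).2

variable [Fintype A] [DiscreteMeasurableSpace A]

theorem measurable_contextWidth (ν : Env A Z) (π : Policy A Z T) (t : Fin T) :
    Measurable (contextWidth ν π t) :=
  Finset.measurable_sum _ fun z _ =>
    ((measurable_contextCount z).comp (measurable_history π t t.isLt.le)).sqrt.inv.mul
      ((Measurable.of_discrete (f := fun a => contextProb ν a z)).comp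
        (measurable_playedAction π t))

/-- Given the history, the context of round `t` has the marginal of the action played, so the
averaged width may be replaced by the width at the observed context, to which the counting bound
applies. -/
theorem integral_contextWidth (ν : Env A Z) (π : Policy A Z T) (t : Fin T) :
    ∫ ω, contextWidth ν π t ω ∂outcomeLaw ν T
      = ∫ ω, (√(contextCount (history π ω t t.isLt.le) (roundObs π ω t).2.1))⁻¹
          ∂outcomeLaw ν T := by
  have hm : Measurable fun p : (Fin t → Obs A Z) × Obs A Z => (√(contextCount p.1 p.2.2.1))⁻¹ :=
    (measurable_contextCount_uncurry.comp (measurable_fst.prodMk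
      (measurable_fst.comp (measurable_snd.comp measurable_snd)))).sqrt.inv
  have key := lintegral_history_roundObs ν π t
    (F := fun h o => ENNReal.ofReal (√(contextCount h o.2.1))⁻¹) hm.ennreal_ofReal
  rw [integral_eq_lintegral_of_nonneg_ae, integral_eq_lintegral_of_nonneg_ae, key]
  · congr 1
    refine lintegral_congr fun ω => ?_
    rw [lintegral_context ν _ (f := fun z => (√(contextCount (history π ω t t.isLt.le) z))⁻¹)
      fun z => (inv_sqrt_contextCount_mem_Icc _ z).1]
    rfl
  · exact Filter.Eventually.of_forall fun ω => (inv_sqrt_contextCount_mem_Icc _ _).1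
  · exact (hm.comp ((measurable_history π t t.isLt.le).prodMk
      (measurable_roundObs π t))).aestronglyMeasurable
  · exact Filter.Eventually.of_forall fun ω => (contextWidth_mem_Icc ν π t ω).1
  · exact (measurable_contextWidth ν π t).aestronglyMeasurable

theorem integrable_contextWidth (ν : Env A Z) (π : Policy A Z T) (t : Fin T) :
    Integrable (contextWidth ν π t) (outcomeLaw ν T) :=
  Integrable.of_mem_Icc 0 1 (measurable_contextWidth ν π t).aemeasurable
    (Filter.Eventually.of_forall fun ω => contextWidth_mem_Icc ν π t ω)

theorem integral_sum_contextWidth_le (ν : Env A Z) (π : Policy A Z T) :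
    ∫ ω, ∑ t, contextWidth ν π t ω ∂outcomeLaw ν T ≤ 3 * √(Fintype.card Z * T) := by
  have hint : ∀ t : Fin T, Integrable (fun ω : Outcomes A Z T =>
      (√(contextCount (history π ω t t.isLt.le) (roundObs π ω t).2.1))⁻¹) (outcomeLaw ν T) :=
    fun t => by
      refine Integrable.of_mem_Icc 0 1 ?_
        (Filter.Eventually.of_forall fun ω => inv_sqrt_contextCount_mem_Icc _ _)
      exact ((measurable_contextCount_uncurry.comp ((measurable_history π t t.isLt.le).prodMk
        (measurable_fst.comp (measurable_snd.comp (measurable_roundObs π t))))).sqrt.inv).aemeasurable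
  rw [integral_finsetSum _ fun t _ => integrable_contextWidth ν π t]
  simp only [integral_contextWidth]
  rw [← integral_finsetSum _ fun t _ => hint t]
  refine (integral_mono (integrable_finsetSum _ fun t _ => hint t) (integrable_const _)
    fun ω => sum_inv_sqrt_contextCount_le π ω).trans ?_
  simp

variable [Nonempty A] [DecidableEq A]

/-- Means lie in `[0, 1]`, so the first `n₀` rounds cost at most `n₀` and the bad event at most `T *
b`. The action widths are summed for each outcome, the context widths only in expectation. -/
theorem regret_le (ν : Env A Z) (π : Policy A Z T) {bad : Set (Outcomes A Z T)} {b c₀ c₁ c₂ : ℝ}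
    {n₀ : ℕ} (hb0 : 0 ≤ b) (hb : outcomeLaw ν T bad ≤ ENNReal.ofReal b) (h₀ : 0 ≤ c₀)
    (h₁ : 0 ≤ c₁) (h₂ : 0 ≤ c₂)
    (h : ∀ ω ∉ bad, ∀ t : Fin T, n₀ ≤ t → ∀ a, meanReward ν a ≤ meanReward ν (playedAction π ω t)
      + (c₀ + c₁ * (√(actionCount (history π ω t t.isLt.le) (playedAction π ω t)))⁻¹
        + c₂ * contextWidth ν π t ω)) :
    regret ν π ≤ n₀ + T * b + T * c₀ + c₁ * (3 * √(Fintype.card A * T))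
      + c₂ * (3 * √(Fintype.card Z * T)) := by
  -- A measurable superset of equal measure spares a proof that `bad` is measurable.
  set B := toMeasurable (outcomeLaw ν T) bad with hB
  have hBm : MeasurableSet B := measurableSet_toMeasurable _ _
  have hBr : (outcomeLaw ν T).real B ≤ b := by
    rw [measureReal_def, hB, measure_toMeasurable]
    exact ENNReal.toReal_le_of_le_ofReal hb0 hb
  set μs := Finset.univ.sup' Finset.univ_nonempty (meanReward ν) with hμs
  have hμs1 : μs ≤ 1 := Finset.sup'_le _ _ fun a _ => (meanReward_mem_Icc ν a).2
  have hpt : ∀ ω, T * μs - (n₀ + T * c₀ + c₁ * (3 * √(Fintype.card A * T)))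
      - c₂ * ∑ t, contextWidth ν π t ω - T * B.indicator (fun _ => 1) ω
      ≤ ∑ t : Fin T, meanReward ν (playedAction π ω t) := fun ω => by
    have hround : ∀ t : Fin T, μs ≤ meanReward ν (playedAction π ω t)
        + (if (t : ℕ) < n₀ then 1 else 0) + c₀
        + c₁ * (√(actionCount (history π ω t t.isLt.le) (playedAction π ω t)))⁻¹
        + c₂ * contextWidth ν π t ω + B.indicator (fun _ => 1) ω := fun t => by
      have e1 : 0 ≤ c₁ * (√(actionCount (history π ω t t.isLt.le) (playedAction π ω t)))⁻¹ := by
        positivity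
      have e2 := mul_nonneg h₂ (contextWidth_mem_Icc ν π t ω).1
      have e3 := (meanReward_mem_Icc ν (playedAction π ω t)).1
      have e4 : 0 ≤ B.indicator (fun _ => (1 : ℝ)) ω := Set.indicator_nonneg (by simp) _
      by_cases ht : (t : ℕ) < n₀
      · rw [if_pos ht]; linarith
      rw [if_neg ht]
      by_cases hω : ω ∈ B
      · rw [Set.indicator_of_mem hω] at e4 ⊢; linarith
      · have := Finset.sup'_le Finset.univ_nonempty (meanReward ν) fun a _ =>
          h ω (fun hb => hω (subset_toMeasurable _ _ hb)) t (not_lt.mp ht) a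
        linarith
    have hsum := Finset.sum_le_sum fun t (_ : t ∈ Finset.univ) => hround t
    simp only [Finset.sum_add_distrib, Finset.sum_const, Finset.card_univ, Fintype.card_fin,
      nsmul_eq_mul, ← Finset.mul_sum] at hsum
    have hA := mul_le_mul_of_nonneg_left (sum_inv_sqrt_actionCount_le π ω) h₁
    have hn : (∑ t : Fin T, if (t : ℕ) < n₀ then (1 : ℝ) else 0) ≤ n₀ := by
      rw [Fin.sum_univ_eq_sum_range (fun t => if t < n₀ then (1 : ℝ) else 0), Finset.sum_boole]
      have : (Finset.range T).filter (· < n₀) ⊆ Finset.range n₀ := fun t ht =>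
        Finset.mem_range.mpr (Finset.mem_filter.mp ht).2
      simpa using Finset.card_le_card this
    linarith
  have i1 : Integrable (fun ω => ∑ t, contextWidth ν π t ω) (outcomeLaw ν T) :=
    integrable_finsetSum _ fun t _ => integrable_contextWidth ν π t
  have i2 : Integrable (B.indicator fun _ => (1 : ℝ)) (outcomeLaw ν T) :=
    (integrable_const 1).indicator hBm
  have i3 : Integrable (fun ω : Outcomes A Z T => ∑ t : Fin T, meanReward ν (playedAction π ω t))
      (outcomeLaw ν T) :=
    integrable_finsetSum _ fun t _ => Integrable.of_mem_Icc 0 1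
      ((Measurable.of_discrete (f := meanReward ν)).comp
        (measurable_playedAction π t)).aemeasurable
      (Filter.Eventually.of_forall fun ω => meanReward_mem_Icc ν _)
  have i4 : Integrable (fun ω : Outcomes A Z T => T * μs - (n₀ + T * c₀
      + c₁ * (3 * √(Fintype.card A * T))) - c₂ * ∑ t, contextWidth ν π t ω) (outcomeLaw ν T) :=
    (integrable_const _).sub (i1.const_mul c₂)
  have hI := integral_mono (i4.sub (i2.const_mul T)) i3 hpt
  rw [integral_sub' i4 (i2.const_mul T), integral_sub (integrable_const _) (i1.const_mul c₂),
    integral_const_mul, integral_const_mul, integral_indicator_const _ hBm] at hI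
  simp only [integral_const, probReal_univ, smul_eq_mul, mul_one] at hI
  have hC := mul_le_mul_of_nonneg_left (integral_sum_contextWidth_le ν π) h₂
  have hTb := mul_le_mul_of_nonneg_left hBr (Nat.cast_nonneg (α := ℝ) T)
  rw [regret]
  linarith

end RegretBound

/-! ### The tolerance and the length of the exploration -/

section Tolerance

theorem tolerance_nonneg (A Z : Type*) [Fintype A] [Fintype Z] (T : ℕ) : 0 ≤ tolerance A Z T := by
  unfold tolerance; positivity

theorem tolerance_sq (A Z : Type*) [Fintype A] [Fintype Z] (T : ℕ) :
    tolerance A Z T ^ 2 = Fintype.card A * Fintype.card Z * Real.log T / √(T : ℝ) := by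
  have hL := Real.log_natCast_nonneg T
  rw [tolerance, div_pow, Real.sq_sqrt (by positivity), ← Real.rpow_natCast,
    ← Real.rpow_mul (Nat.cast_nonneg T), Real.sqrt_eq_rpow]
  norm_num

theorem le_explore₁ (A : Type*) [Fintype A] (T : ℕ) :
    4 * √(T : ℝ) / Fintype.card A ≤ explore₁ A T := Nat.le_ceil _

theorem explore₁_pos (A : Type*) [Fintype A] [Nonempty A] {T : ℕ} (hT : 0 < T) : 0 < explore₁ A T := by
  refine Nat.ceil_pos.mpr ?_
  have : (0 : ℝ) < Fintype.card A := Nat.cast_pos.mpr Fintype.card_pos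
  positivity

/-- The first phase is calibrated to this: `4 * √T / |A|` samples against a squared tolerance of
`|A| * |Z| * log T / √T`. -/
theorem card_mul_log_le_explore₁_mul (A Z : Type*) [Fintype A] [Nonempty A] [Fintype Z] {T : ℕ}
    (hT : 0 < T) :
    4 * (Fintype.card Z * Real.log T) ≤ explore₁ A T * tolerance A Z T ^ 2 := by
  have hA : (0 : ℝ) < Fintype.card A := Nat.cast_pos.mpr Fintype.card_pos
  have hs : 0 < √(T : ℝ) := Real.sqrt_pos.mpr (Nat.cast_pos.mpr hT)
  refine le_trans (le_of_eq ?_) (mul_le_mul_of_nonneg_right (le_explore₁ A T) (sq_nonneg _))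
  rw [tolerance_sq]
  field_simp

end Tolerance

/-! ### Rounds on the good event -/

section Rounds

theorem sum_mul_le_add {Z : Type*} [Fintype Z] {f w p : Z → ℝ} {c e : ℝ} (hf0 : ∀ z, 0 ≤ f z)
    (hfc : ∀ z, f z ≤ c) (hc : 0 ≤ c) (h : ∑ z, |w z - p z| ≤ e) :
    ∑ z, f z * w z ≤ ∑ z, f z * p z + c * e := by
  have : ∑ z, f z * w z - ∑ z, f z * p z ≤ ∑ z, c * |w z - p z| := by
    rw [← Finset.sum_sub_distrib]
    refine Finset.sum_le_sum fun z _ => ?_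
    rw [← mul_sub]
    exact (mul_le_mul_of_nonneg_left (le_abs_self _) (hf0 z)).trans
      (mul_le_mul_of_nonneg_right (hfc z) (abs_nonneg _))
  rw [← Finset.mul_sum] at this
  linarith [mul_le_mul_of_nonneg_left h hc]

theorem le_argmax {A : Type*} [Fintype A] [LinearOrder A] [Nonempty A] (f : A → ℝ) (b : A) :
    f b ≤ f (argmax f) := by
  classical
  have := Finset.min'_mem (Finset.univ.filter fun a => ∀ b, f b ≤ f a) (by
    obtain ⟨a, ha⟩ := Finite.exists_max f
    exact ⟨a, by simpa using ha⟩)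
  have h := (Finset.mem_filter.mp this).2 b
  rw [argmax]
  convert h

theorem log_div_confidence {T : ℕ} (hT : 0 < T) (x : ℝ) :
    Real.log (2 / confidence T) / (2 * x) = Real.log T / x := by
  have : (T : ℝ) ≠ 0 := by positivity
  rw [confidence, div_div_cancel₀ two_ne_zero, Real.log_pow]
  exact mul_div_mul_left _ _ two_ne_zero

variable {A Z : Type*} {n T : ℕ}

theorem ucbAction_confidence [DecidableEq A] (hT : 0 < T) (h : Fin n → Obs A Z) (a : A) :
    ucbAction (confidence T) h a = actionMean h a + √(Real.log T / actionCount h a) := by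
  rw [ucbAction, log_div_confidence hT]

theorem ucbContext_confidence [DecidableEq Z] (hT : 0 < T) (h : Fin n → Obs A Z) (z : Z) :
    ucbContext (confidence T) h z = contextMean h z + √(Real.log T / contextCount h z) := by
  rw [ucbContext, log_div_confidence hT]

theorem sqrt_log_div_contextCount_le [DecidableEq Z] (h : Fin n → Obs A Z) (z : Z) :
    √(Real.log T / contextCount h z) ≤ √(Real.log T) :=
  Real.sqrt_le_sqrt (div_le_self (Real.log_natCast_nonneg T) (one_le_contextCount h z))

/-- The empirical means of all contexts are within their confidence radii of `m`. -/
def ContextsWithin [DecidableEq Z] (m : Z → ℝ) (T : ℕ) (h : Fin n → Obs A Z) : Prop :=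
  ∀ z, |contextMean h z - m z| ≤ √(Real.log T / contextCount h z)

theorem ContextsWithin.le_pseudoUCB [Fintype Z] [DecidableEq Z] {m : Z → ℝ} {h : Fin n → Obs A Z}
    (hC : ContextsWithin m T h) (hT : 0 < T) {w : A → Z → ℝ} {a : A} (hw : ∀ z, 0 ≤ w a z) :
    ∑ z, m z * w a z ≤ pseudoUCB (confidence T) w h a := by
  refine Finset.sum_le_sum fun z _ => mul_le_mul_of_nonneg_right ?_ (hw z)
  rw [ucbContext_confidence hT]
  linarith [(abs_le.mp (hC z)).1]

theorem ContextsWithin.pseudoUCB_le [Fintype Z] [DecidableEq Z] {m : Z → ℝ} {h : Fin n → Obs A Z}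
    (hC : ContextsWithin m T h) (hT : 0 < T) {w : A → Z → ℝ} {a : A} (hw : ∀ z, 0 ≤ w a z) :
    pseudoUCB (confidence T) w h a
      ≤ ∑ z, m z * w a z + 2 * ∑ z, √(Real.log T / contextCount h z) * w a z := by
  rw [Finset.mul_sum, ← Finset.sum_add_distrib]
  refine Finset.sum_le_sum fun z _ => ?_
  rw [← mul_assoc, ← add_mul]
  refine mul_le_mul_of_nonneg_right ?_ (hw z)
  rw [ucbContext_confidence hT]
  linarith [(abs_le.mp (hC z)).2]

variable [MeasurableSpace Z]

/-- The empirical means of all actions are within their confidence radii of the true means. -/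
def ActionsWithin [DecidableEq A] (ν : Env A Z) (T : ℕ) (h : Fin n → Obs A Z) : Prop :=
  ∀ a, |actionMean h a - meanReward ν a| ≤ √(Real.log T / actionCount h a)

theorem ActionsWithin.le_ucbAction [DecidableEq A] {ν : Env A Z} {h : Fin n → Obs A Z}
    (hA : ActionsWithin ν T h) (hT : 0 < T) (a : A) :
    meanReward ν a ≤ ucbAction (confidence T) h a := by
  rw [ucbAction_confidence hT]
  linarith [(abs_le.mp (hA a)).1]

theorem ActionsWithin.ucbAction_le [DecidableEq A] {ν : Env A Z} {h : Fin n → Obs A Z}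
    (hA : ActionsWithin ν T h) (hT : 0 < T) (a : A) :
    ucbAction (confidence T) h a ≤ meanReward ν a + 2 * √(Real.log T / actionCount h a) := by
  rw [ucbAction_confidence hT]
  linarith [(abs_le.mp (hA a)).2]

variable [Fintype A] [LinearOrder A]

theorem meanReward_le_of_argmax_ucbAction [Nonempty A] {ν : Env A Z} {h : Fin n → Obs A Z}
    (hA : ActionsWithin ν T h) (hT : 0 < T) (a : A) :
    meanReward ν a ≤ meanReward ν (argmax (ucbAction (confidence T) h))
      + 2 * √(Real.log T / actionCount h (argmax (ucbAction (confidence T) h))) :=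
  (hA.le_ucbAction hT a).trans ((le_argmax _ a).trans (hA.ucbAction_le hT _))

variable [Fintype Z] [DecidableEq Z]

/-- The chain is: mean of `a`, its UCB, its pseudo UCB, the pseudo UCB of `b`, the UCB of `b`, mean
of `b`. The test pays for the two passages between the kinds of bound, one tolerance each; validity
of the context intervals is not needed. -/
theorem meanReward_le_of_testPasses [Nonempty A] {ν : Env A Z} {w : A → Z → ℝ} {h : Fin n → Obs A Z}
    (hA : ActionsWithin ν T h) (hT : 0 < T) (htest : TestPasses T w h) (a : A) {b : A}
    (hb : b = argmax (pseudoUCB (confidence T) (workingMarginals T w h) h)) {e : ℝ}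
    (hw : ∑ z, |workingMarginals T w h b z - contextProb ν b z| ≤ e) :
    meanReward ν a ≤ meanReward ν b + 2 * tolerance A Z T + 2 * √(Real.log T / actionCount h a)
      + 2 * √(Real.log T / actionCount h b)
      + 2 * (∑ z, √(Real.log T / contextCount h z) * contextProb ν b z + √(Real.log T) * e) := by
  have h1 := hA.le_ucbAction hT a
  have h2 := (htest a).2
  have h3 := le_argmax (pseudoUCB (confidence T) (workingMarginals T w h) h) a
  rw [← hb] at h3
  have h4 := (htest b).1
  have h5 := hA.ucbAction_le hT b
  have h6 := sum_mul_le_add (f := fun z => √(Real.log T / contextCount h z))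
    (fun z => Real.sqrt_nonneg _) (fun z => sqrt_log_div_contextCount_le h z)
    (Real.sqrt_nonneg _) hw
  rw [ucbDiff] at h2 h4
  linarith

section Benign

variable {ν : Env A Z} {w : A → Z → ℝ} {h : Fin n → Obs A Z} {m : Z → ℝ} {ε : ℝ}

/-- Both bounds estimate the same mean from above, each with an error of at most twice its radius;
the pseudo bound is off by a further `ε ≤ tolerance` from the weights. The shift by the tolerance in
`ucbDiff` absorbs this on the lower side, and the term `2 * tolerance` on the upper. -/
theorem testPasses_of_within (hA : ActionsWithin ν T h) (hC : ContextsWithin m T h) (hT : 0 < T)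
    (hw : ∀ a z, 0 ≤ w a z) (hW : workingMarginals T w h = w)
    (hm : ∀ a, meanReward ν a = ∑ z, m z * contextProb ν a z)
    (hm01 : ∀ z, m z ∈ Set.Icc (0 : ℝ) 1) (hε : ε ≤ tolerance A Z T)
    (hclose : ∀ a, ∑ z, |w a z - contextProb ν a z| ≤ ε) : TestPasses T w h := by
  intro a
  have h1 := hA.le_ucbAction hT a
  have h2 := hA.ucbAction_le hT a
  have h3 := hC.le_pseudoUCB hT (hw a)
  have h4 := hC.pseudoUCB_le hT (hw a)
  have h5 := sum_mul_le_add (fun z => (hm01 z).1) (fun z => (hm01 z).2) zero_le_one (hclose a)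
  have h6 := sum_mul_le_add (w := contextProb ν a) (p := w a) (e := ε) (fun z => (hm01 z).1)
    (fun z => (hm01 z).2) zero_le_one (by simpa only [abs_sub_comm] using hclose a)
  rw [← hm a] at h5 h6
  rw [ucbDiff, hW]
  constructor <;> linarith

/-- UCB over contexts. Exchanging weights costs `ε` in the mean of `a` and again in that of `b`, and
`√(log T) * ε` in the width, since each radius is at most `√(log T)`. -/
theorem meanReward_le_of_argmax_pseudoUCB [Nonempty A] (hC : ContextsWithin m T h) (hT : 0 < T)
    (hw : ∀ a z, 0 ≤ w a z)
    (hm : ∀ a, meanReward ν a = ∑ z, m z * contextProb ν a z)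
    (hm01 : ∀ z, m z ∈ Set.Icc (0 : ℝ) 1)
    (hclose : ∀ a, ∑ z, |w a z - contextProb ν a z| ≤ ε) (a : A) {b : A}
    (hb : b = argmax (pseudoUCB (confidence T) w h)) :
    meanReward ν a ≤ meanReward ν b + 2 * ε
      + 2 * (∑ z, √(Real.log T / contextCount h z) * contextProb ν b z + √(Real.log T) * ε) := by
  have h1 := le_argmax (pseudoUCB (confidence T) w h) a
  rw [← hb] at h1
  have h3 := hC.le_pseudoUCB hT (hw a)
  have h4 := hC.pseudoUCB_le hT (hw b)
  have h5 := sum_mul_le_add (fun z => (hm01 z).1) (fun z => (hm01 z).2) zero_le_one (hclose b)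
  have h6 := sum_mul_le_add (w := contextProb ν a) (p := w a) (e := ε) (fun z => (hm01 z).1)
    (fun z => (hm01 z).2) zero_le_one (by simpa only [abs_sub_comm] using hclose a)
  have h7 := sum_mul_le_add (f := fun z => √(Real.log T / contextCount h z))
    (fun z => Real.sqrt_nonneg _) (fun z => sqrt_log_div_contextCount_le h z)
    (Real.sqrt_nonneg _) (hclose b)
  rw [← hm a] at h6
  rw [← hm b] at h5
  linarith

end Benign

/-- Marginals that are kept lie within two tolerances of the estimate, and the estimate within one
of the truth. Hence even arbitrary input marginals do bounded harm. -/
theorem sum_abs_workingMarginals_le {ν : Env A Z} {w : A → Z → ℝ} {h : Fin n → Obs A Z}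
    (hmle : ∀ a, ∑ z, |mle T h a z - contextProb ν a z| ≤ tolerance A Z T) (a : A) :
    ∑ z, |workingMarginals T w h a z - contextProb ν a z| ≤ 3 * tolerance A Z T := by
  unfold workingMarginals
  split_ifs with hex
  · linarith [hmle a, tolerance_nonneg A Z T]
  · push Not at hex
    have : ∑ z, |w a z - contextProb ν a z|
        ≤ ∑ z, |w a z - mle T h a z| + ∑ z, |mle T h a z - contextProb ν a z| := by
      rw [← Finset.sum_add_distrib]
      exact Finset.sum_le_sum fun z _ => abs_sub_le _ _ _
    linarith [hmle a, hex a]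

theorem workingMarginals_eq_self {ν : Env A Z} {w : A → Z → ℝ} {h : Fin n → Obs A Z}
    (hmle : ∀ a, ∑ z, |mle T h a z - contextProb ν a z| ≤ tolerance A Z T)
    (hclose : ∀ a, ∑ z, |w a z - contextProb ν a z| ≤ tolerance A Z T) :
    workingMarginals T w h = w := by
  unfold workingMarginals
  refine if_neg ?_
  push Not
  intro a
  have : ∑ z, |w a z - mle T h a z|
      ≤ ∑ z, |w a z - contextProb ν a z| + ∑ z, |mle T h a z - contextProb ν a z| := by
    rw [← Finset.sum_add_distrib]
    refine Finset.sum_le_sum fun z _ => ?_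
    rw [abs_sub_comm (mle T h a z)]
    exact abs_sub_le _ _ _
  linarith [hmle a, hclose a]

end Rounds

/-! ### Probability of the good event -/

section GoodEvent

variable {A Z : Type*} [MeasurableSpace Z]

/-- Under `a'` the event is everything or empty, so the condition of a common conditional mean holds
in every environment. -/
theorem integral_cond_action (ν : Env A Z) (g : Obs A Z → ℝ) (a a' : A)
    (h : (ν a' : Measure (Z × unitInterval)) {x | ((a', x) : Obs A Z).1 = a} ≠ 0) :
    ∫ x, g (a', x) ∂(cond (ν a' : Measure (Z × unitInterval)) {x | ((a', x) : Obs A Z).1 = a})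
      = ∫ x, g (a, x) ∂(ν a : Measure (Z × unitInterval)) := by
  by_cases ha : a' = a
  · subst ha
    simp
  · simp [ha] at h

theorem integral_context [Fintype Z] [DiscreteMeasurableSpace Z] (ν : Env A Z) (a : A) {f : Z → ℝ}
    (hf : ∀ z, 0 ≤ f z) :
    ∫ x, f x.1 ∂(ν a : Measure (Z × unitInterval)) = ∑ z, f z * contextProb ν a z := by
  rw [integral_eq_lintegral_of_nonneg_ae (Filter.Eventually.of_forall fun x => hf _)
    (Measurable.of_discrete.comp measurable_fst).aestronglyMeasurable, lintegral_context ν a hf,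
    ENNReal.toReal_ofReal (Finset.sum_nonneg fun z _ =>
      mul_nonneg (hf z) (contextProb_nonneg ν a z))]

theorem meanReward_eq_sum [Fintype Z] [DiscreteMeasurableSpace Z] (ν : Env A Z) (a : A) {m : Z → ℝ}
    (hm : ∀ z, (ν a : Measure (Z × unitInterval)) (Prod.fst ⁻¹' {z}) ≠ 0 →
      ∫ x, (x.2 : ℝ) ∂(cond (ν a : Measure (Z × unitInterval)) (Prod.fst ⁻¹' {z})) = m z) :
    meanReward ν a = ∑ z, m z * contextProb ν a z := by
  classical
  have hi : Integrable (fun x : Z × unitInterval => (x.2 : ℝ))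
      (ν a : Measure (Z × unitInterval)) :=
    Integrable.of_mem_Icc 0 1 (measurable_subtype_coe.comp measurable_snd).aemeasurable
      (Filter.Eventually.of_forall fun x => x.2.2)
  have hs : ∀ z : Z, MeasurableSet (Prod.fst ⁻¹' {z} : Set (Z × unitInterval)) := fun z =>
    measurable_fst (measurableSet_singleton z)
  have hdec : ∀ x : Z × unitInterval, (x.2 : ℝ)
      = ∑ z, (Prod.fst ⁻¹' {z} : Set (Z × unitInterval)).indicator (fun x => (x.2 : ℝ)) x :=
    fun x => by simp [Set.indicator_apply]
  rw [meanReward, integral_congr_ae (Filter.Eventually.of_forall hdec),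
    integral_finsetSum _ fun z _ => hi.indicator (hs z)]
  refine Finset.sum_congr rfl fun z _ => ?_
  rw [integral_indicator (hs z), contextProb]
  by_cases h0 : (ν a : Measure (Z × unitInterval)) (Prod.fst ⁻¹' {z}) = 0
  · rw [setIntegral_measure_zero _ h0, measureReal_def, h0]
    simp
  · rw [← hm z h0, ProbabilityTheory.cond, integral_smul_measure, ENNReal.toReal_inv, smul_eq_mul,
      measureReal_def, mul_right_comm, inv_mul_cancel₀ (ENNReal.toReal_ne_zero.mpr
        ⟨h0, measure_ne_top _ _⟩), one_mul]

variable [Fintype A] [MeasurableSpace A] [DiscreteMeasurableSpace A] {T : ℕ}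

theorem measure_not_contextsWithin_le [Fintype Z] [DecidableEq Z]
    [DiscreteMeasurableSpace Z] (ν : Env A Z) (π : Policy A Z T) (hT : 3 ≤ T) {m : Z → ℝ}
    (hm01 : ∀ z, m z ∈ Set.Icc (0 : ℝ) 1)
    (hm : ∀ a z, (ν a : Measure (Z × unitInterval)) (Prod.fst ⁻¹' {z}) ≠ 0 →
      ∫ x, (x.2 : ℝ) ∂(cond (ν a : Measure (Z × unitInterval)) (Prod.fst ⁻¹' {z})) = m z) :
    outcomeLaw ν T {ω | ∃ (n : ℕ) (hn : n ≤ T), ¬ ContextsWithin m T (history π ω n hn)}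
      ≤ ENNReal.ofReal (Fintype.card Z * (2 / T)) := by
  have key : ∀ z ∈ (Finset.univ : Finset Z), _ := fun z _ =>
    measure_not_mem_confidence_le ν π hT (P := fun o => o.2.1 = z) (measurableSet_context z)
      (g := fun o => (o.2.2 : ℝ)) measurable_reward (fun o => o.2.2.2) (hm01 z)
      fun a h => hm a z h
  refine le_trans (measure_mono ?_) ((measure_biUnion_finset_le _ _).trans
    ((Finset.sum_le_sum key).trans_eq ?_))
  · rintro ω ⟨n, hn, h⟩
    simp only [ContextsWithin, not_forall, not_le] at h
    obtain ⟨z, hz⟩ := h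
    rw [contextMean, contextCount_eq] at hz
    simp only [Set.mem_iUnion]
    exact ⟨z, Finset.mem_univ z, n, hn, hz⟩
  · rw [Finset.sum_const, nsmul_eq_mul, Finset.card_univ, ← ENNReal.ofReal_natCast,
      ← ENNReal.ofReal_mul (Nat.cast_nonneg _)]

variable [LinearOrder A]

theorem measure_not_actionsWithin_le (ν : Env A Z) (π : Policy A Z T) (hT : 3 ≤ T) :
    outcomeLaw ν T {ω | ∃ (n : ℕ) (hn : n ≤ T), ¬ ActionsWithin ν T (history π ω n hn)}
      ≤ ENNReal.ofReal (Fintype.card A * (2 / T)) := by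
  have key : ∀ a ∈ (Finset.univ : Finset A), _ := fun a _ =>
    measure_not_mem_confidence_le ν π hT (P := fun o => o.1 = a) (measurableSet_action a)
      (g := fun o => (o.2.2 : ℝ)) measurable_reward (fun o => o.2.2.2) (meanReward_mem_Icc ν a)
      fun a' h => integral_cond_action ν (fun o => (o.2.2 : ℝ)) a a' h
  refine le_trans (measure_mono ?_) ((measure_biUnion_finset_le _ _).trans
    ((Finset.sum_le_sum key).trans_eq ?_))
  · rintro ω ⟨n, hn, h⟩
    simp only [ActionsWithin, not_forall, not_le] at h
    obtain ⟨a, ha⟩ := h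
    rw [actionMean, actionCount_eq] at ha
    simp only [Set.mem_iUnion]
    exact ⟨a, Finset.mem_univ a, n, hn, ha⟩
  · rw [Finset.sum_const, nsmul_eq_mul, Finset.card_univ, ← ENNReal.ofReal_natCast,
      ← ENNReal.ofReal_mul (Nat.cast_nonneg _)]

variable [Fintype Z] [DecidableEq Z] [DiscreteMeasurableSpace Z]

theorem measure_mle_far_le [Nonempty A] [Nonempty Z] (ν : Env A Z)
    (q : A → ProbabilityMeasure Z) (hT : 3 ≤ T) (a : A) :
    outcomeLaw ν T {ω | ∃ hn : Fintype.card A * explore₁ A T ≤ T, tolerance A Z T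
        < ∑ z, |mle T (history (hacUCB T q) ω _ hn) a z - contextProb ν a z|}
      ≤ ENNReal.ofReal (2 / (T : ℝ) ^ 2) := by
  have hT0 : (0 : ℝ) < T := by positivity
  have hn1 : 0 < explore₁ A T := explore₁_pos A (by omega)
  have hn1' : (0 : ℝ) < explore₁ A T := Nat.cast_pos.mpr hn1
  set κ := tolerance A Z T with hκ
  have hκ0 : 0 ≤ κ := tolerance_nonneg A Z T
  set π := hacUCB T q with hπ
  -- One event for each of the `2 ^ |Z|` sets of contexts. The Hoeffding exponent is `explore₁ * κ ^
  -- 2 / 2 ≥ 2 * |Z| * log T`, which leaves `(2 / T ^ 2) ^ |Z|` after the union bound.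
  have key : ∀ B ∈ (Finset.univ : Finset (Finset Z)), outcomeLaw ν T
      {ω | ∃ (n : ℕ) (hn : n ≤ T), visits (fun o => o.1 = a) (history π ω n hn) = explore₁ A T ∧
        explore₁ A T * κ / 2 ≤ deviation (fun o => o.1 = a)
          (fun o => if o.2.1 ∈ B then 1 else 0) (∑ z ∈ B, contextProb ν a z) (history π ω n hn)}
      ≤ ENNReal.ofReal (Real.exp (-(2 * Real.log T)) ^ Fintype.card Z) := fun B _ => by
    refine (measure_le_deviation_le ν π (measurableSet_action a)
      (g := fun o => if o.2.1 ∈ B then 1 else 0) ?_ ?_ ?_ hn1 (by positivity)).trans ?_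
    · exact Measurable.ite ((measurable_fst.comp measurable_snd) (.of_discrete (s := {z | z ∈ B})))
        measurable_const measurable_const
    · intro o
      split_ifs <;> simp
    · intro a' h
      rw [integral_cond_action ν (fun o => if o.2.1 ∈ B then (1 : ℝ) else 0) a a' h,
        integral_context ν a (f := fun z => if z ∈ B then 1 else 0)
          fun z => by split_ifs <;> norm_num]
      simp
    · rw [← Real.exp_nat_mul]
      refine ENNReal.ofReal_le_ofReal (Real.exp_le_exp.mpr ?_)
      have := card_mul_log_le_explore₁_mul A Z (T := T) (by omega)
      have he : -2 * (explore₁ A T * κ / 2) ^ 2 / explore₁ A T = -(explore₁ A T * κ ^ 2 / 2) := by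
        field_simp
      rw [he]
      linarith
  have hsub : {ω | ∃ hn : Fintype.card A * explore₁ A T ≤ T, κ
        < ∑ z, |mle T (history π ω _ hn) a z - contextProb ν a z|}
      ⊆ ⋃ B ∈ (Finset.univ : Finset (Finset Z)), {ω | ∃ (n : ℕ) (hn : n ≤ T),
        visits (fun o => o.1 = a) (history π ω n hn) = explore₁ A T ∧
        explore₁ A T * κ / 2 ≤ deviation (fun o => o.1 = a)
          (fun o => if o.2.1 ∈ B then 1 else 0) (∑ z ∈ B, contextProb ν a z)
          (history π ω n hn)} := by
    rintro ω ⟨hn, hlt⟩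
    have hv := visits_explore₁ q ω hn hn1 a
    have hv0 : visits (fun o => o.1 = a) (history π ω _ hn) ≠ 0 := by rw [hv]; omega
    simp only [Set.mem_iUnion]
    refine ⟨Finset.univ.filter fun z => 0 ≤ mle T (history π ω _ hn) a z - contextProb ν a z,
      Finset.mem_univ _, _, hn, hv, ?_⟩
    rw [sum_abs_eq_two_mul_sum_filter (by
      rw [Finset.sum_sub_distrib, sum_mle T _ a hv0, sum_contextProb, sub_self]),
      Finset.sum_sub_distrib] at hlt
    rw [deviation_eq, ← sum_mle_mul T _ a hv0, hv]
    nlinarith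
  have hexp : Real.exp (-(2 * Real.log T)) = 1 / (T : ℝ) ^ 2 := by
    rw [Real.exp_neg, mul_comm, Real.exp_mul, Real.exp_log hT0]
    simp
  refine (measure_mono hsub).trans ((measure_biUnion_finset_le _ _).trans
    ((Finset.sum_le_sum key).trans ?_))
  rw [Finset.sum_const, Finset.card_univ, Fintype.card_finset, nsmul_eq_mul,
    ← ENNReal.ofReal_natCast, ← ENNReal.ofReal_mul (Nat.cast_nonneg _), hexp, Nat.cast_pow,
    ← mul_pow]
  refine ENNReal.ofReal_le_ofReal ?_
  rw [show ((2 : ℕ) : ℝ) * (1 / (T : ℝ) ^ 2) = 2 / (T : ℝ) ^ 2 by push_cast; ring]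
  have hT3 : (3 : ℝ) ≤ T := by exact_mod_cast hT
  refine pow_le_of_le_one (by positivity) ?_ Fintype.card_ne_zero
  rw [div_le_one (by positivity)]
  nlinarith

end GoodEvent

/-! ### The regret of HAC-UCB -/

section Regret

/-- The number of rounds of the two exploration phases. -/
noncomputable def exploreTotal (A : Type*) [Fintype A] (T : ℕ) : ℕ :=
  Fintype.card A * (explore₁ A T + explore₂ A T)

theorem card_mul_explore₁_le_exploreTotal (A : Type*) [Fintype A] (T : ℕ) :
    Fintype.card A * explore₁ A T ≤ exploreTotal A T :=
  Nat.mul_le_mul_left _ (Nat.le_add_right _ _)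

theorem exploreTotal_le (A : Type*) [Fintype A] [Nonempty A] (T : ℕ) :
    (exploreTotal A T : ℝ) ≤ 5 * √(T : ℝ) + 2 * Fintype.card A := by
  have hA : (0 : ℝ) < Fintype.card A := Nat.cast_pos.mpr Fintype.card_pos
  have h1 : (explore₁ A T : ℝ) < 4 * √(T : ℝ) / Fintype.card A + 1 :=
    Nat.ceil_lt_add_one (by positivity)
  have h2 : (explore₂ A T : ℝ) < √(T : ℝ) / Fintype.card A + 1 :=
    Nat.ceil_lt_add_one (by positivity)
  rw [exploreTotal]
  push_cast
  calc _ ≤ (Fintype.card A : ℝ)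
        * ((4 * √(T : ℝ) / Fintype.card A + 1) + (√(T : ℝ) / Fintype.card A + 1)) := by gcongr
    _ = _ := by field_simp; ring

theorem sqrt_log_div_eq {T : ℕ} (N : ℝ) :
    √(Real.log T / N) = √(Real.log T) * (√N)⁻¹ := by
  rw [Real.sqrt_div (Real.log_natCast_nonneg T), div_eq_mul_inv]

theorem testPasses_of_flagUp {A Z : Type*} [Fintype A] [LinearOrder A] [Fintype Z]
    [DecidableEq Z] {T n : ℕ} {w : A → Z → ℝ} {h : Fin n → Obs A Z}
    (hn : exploreTotal A T ≤ n) (hf : FlagUp T w h) : TestPasses T w h :=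
  hf (Fin.last n) hn

theorem mle_history {A Z : Type*} [Fintype A] [LinearOrder A] [DecidableEq Z]
    [MeasurableSpace A] [MeasurableSpace Z] {T : ℕ} (π : Policy A Z T) (ω : Outcomes A Z T) {n : ℕ}
    (hn : Fintype.card A * explore₁ A T ≤ n) (hnT : n ≤ T) :
    mle T (history π ω n hnT) = mle T (history π ω _ (hn.trans hnT)) := by
  rw [mle_castLE T hn, history_comp_castLE]

theorem sum_sqrt_mul_contextProb {A Z : Type*} [Fintype Z] [DecidableEq Z]
    [MeasurableSpace A] [MeasurableSpace Z] {T : ℕ} (ν : Env A Z) (π : Policy A Z T) (t : Fin T)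
    (ω : Outcomes A Z T) :
    ∑ z, √(Real.log T / contextCount (history π ω t t.isLt.le) z)
        * contextProb ν (playedAction π ω t) z
      = √(Real.log T) * contextWidth ν π t ω := by
  simp only [contextWidth, Finset.mul_sum, sqrt_log_div_eq, mul_assoc]

/-- The witness is the conditional mean under `p`. Where `p` does not charge `z`, the conditional
measure is zero and the value is 0, still in `[0, 1]`. -/
theorem exists_conditional_mean {A Z : Type*} [MeasurableSpace Z] {ν : Env A Z}
    (hν : ConditionallyBenign ν) :
    ∃ m : Z → ℝ, (∀ z, m z ∈ Set.Icc (0 : ℝ) 1) ∧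
      ∀ a z, (ν a : Measure (Z × unitInterval)) (Prod.fst ⁻¹' {z}) ≠ 0 →
        ∫ x, (x.2 : ℝ) ∂(cond (ν a : Measure (Z × unitInterval)) (Prod.fst ⁻¹' {z})) = m z := by
  obtain ⟨p, hp⟩ := hν
  have hmap : ∀ ρ : Measure (Z × unitInterval),
      ∫ x, (x.2 : ℝ) ∂ρ = ∫ y : unitInterval, (y : ℝ) ∂(ρ.map Prod.snd) := fun ρ =>
    (integral_map measurable_snd.aemeasurable measurable_subtype_coe.aestronglyMeasurable).symm
  refine ⟨fun z => ∫ x, (x.2 : ℝ) ∂(cond (p : Measure (Z × unitInterval)) (Prod.fst ⁻¹' {z})),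
    fun z => ⟨integral_nonneg fun x => x.2.2.1, ?_⟩, fun a z h => ?_⟩
  · by_cases h0 : (p : Measure (Z × unitInterval)) (Prod.fst ⁻¹' {z}) = 0
    · simp only [cond_eq_zero_of_meas_eq_zero h0, integral_zero_measure, zero_le_one]
    · have := cond_isProbabilityMeasure h0
      refine (integral_mono (Integrable.of_mem_Icc 0 1
        (measurable_subtype_coe.comp measurable_snd).aemeasurable
        (Filter.Eventually.of_forall fun x => x.2.2)) (integrable_const 1) fun x => x.2.2.2).trans ?_
      simp
  · rw [hmap, (hp a).2 z h, ← hmap]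

variable {A Z : Type*} [Fintype A] [LinearOrder A] [Nonempty A] [MeasurableSpace A]
  [DiscreteMeasurableSpace A] [Fintype Z] [DecidableEq Z] [MeasurableSpace Z]
  [DiscreteMeasurableSpace Z] {T : ℕ}

/-- The weights that the probability measures `q` give to the contexts. -/
noncomputable def marginalWeights (q : A → ProbabilityMeasure Z) (a : A) (z : Z) : ℝ :=
  (q a : Measure Z).real {z}

open Classical in
theorem playedAction_hacUCB (q : A → ProbabilityMeasure Z) (ω : Outcomes A Z T) (t : Fin T)
    (ht : exploreTotal A T ≤ t) :
    playedAction (hacUCB T q) ω t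
      = if FlagUp T (marginalWeights q) (history (hacUCB T q) ω t t.isLt.le)
        then argmax (pseudoUCB (confidence T) (workingMarginals T (marginalWeights q)
          (history (hacUCB T q) ω t t.isLt.le)) (history (hacUCB T q) ω t t.isLt.le))
        else argmax (ucbAction (confidence T) (history (hacUCB T q) ω t t.isLt.le)) := by
  rw [exploreTotal, mul_add] at ht
  change hacAct T (marginalWeights q) _ _ = _
  rw [hacAct, dif_neg (by omega), dif_neg (by omega)]

/-- The outcomes for which the confidence bounds of some action, or the empirical context
marginals of the first exploration phase, are off. -/
def atypical (ν : Env A Z) (q : A → ProbabilityMeasure Z) (T : ℕ) : Set (Outcomes A Z T) :=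
  {ω | ∃ (n : ℕ) (hn : n ≤ T), ¬ ActionsWithin ν T (history (hacUCB T q) ω n hn)} ∪
    ⋃ a ∈ (Finset.univ : Finset A), {ω | ∃ hn : Fintype.card A * explore₁ A T ≤ T,
      tolerance A Z T
        < ∑ z, |mle T (history (hacUCB T q) ω _ hn) a z - contextProb ν a z|}

theorem measure_atypical_le [Nonempty Z] (ν : Env A Z) (q : A → ProbabilityMeasure Z)
    (hT : 3 ≤ T) :
    outcomeLaw ν T (atypical ν q T)
      ≤ ENNReal.ofReal (Fintype.card A * (2 / T) + Fintype.card A * (2 / (T : ℝ) ^ 2)) := by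
  rw [ENNReal.ofReal_add (by positivity) (by positivity)]
  refine (measure_union_le _ _).trans (add_le_add (measure_not_actionsWithin_le ν _ hT) ?_)
  refine (measure_biUnion_finset_le _ _).trans
    ((Finset.sum_le_sum fun a _ => measure_mle_far_le ν q hT a).trans_eq ?_)
  rw [Finset.sum_const, nsmul_eq_mul, Finset.card_univ, ← ENNReal.ofReal_natCast,
    ← ENNReal.ofReal_mul (Nat.cast_nonneg _)]

theorem actionsWithin_of_notMem_atypical {ν : Env A Z} {q : A → ProbabilityMeasure Z}
    {ω : Outcomes A Z T} (hω : ω ∉ atypical ν q T) (n : ℕ) (hn : n ≤ T) :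
    ActionsWithin ν T (history (hacUCB T q) ω n hn) := by
  by_contra h
  exact hω (Or.inl ⟨n, hn, h⟩)

theorem mle_close_of_notMem_atypical {ν : Env A Z} {q : A → ProbabilityMeasure Z}
    {ω : Outcomes A Z T} (hω : ω ∉ atypical ν q T) {n : ℕ} (hn : exploreTotal A T ≤ n)
    (hnT : n ≤ T) (a : A) :
    ∑ z, |mle T (history (hacUCB T q) ω n hnT) a z - contextProb ν a z| ≤ tolerance A Z T := by
  have h1 := (card_mul_explore₁_le_exploreTotal A T).trans hn
  rw [mle_history _ _ h1 hnT]
  by_contra h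
  refine hω (Or.inr ?_)
  simp only [Set.mem_iUnion]
  exact ⟨a, Finset.mem_univ a, h1.trans hnT, not_le.mp h⟩

/-- The width of an optimal action that is seldom played cannot be summed over the rounds. The first
phase has sampled every action often enough for this width to stay below the tolerance. -/
theorem sqrt_log_div_actionCount_le [Nonempty Z] (q : A → ProbabilityMeasure Z)
    (ω : Outcomes A Z T) (hT : 0 < T) {n : ℕ} (hn : exploreTotal A T ≤ n) (hnT : n ≤ T) (a : A) :
    2 * √(Real.log T / actionCount (history (hacUCB T q) ω n hnT) a) ≤ tolerance A Z T := by
  have hL := Real.log_natCast_nonneg T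
  have h1 := (card_mul_explore₁_le_exploreTotal A T).trans hn
  have hv := visits_explore₁ q ω (h1.trans hnT) (explore₁_pos A hT) a
  rw [← history_comp_castLE _ _ h1 hnT] at hv
  have hle := visits_castLE_le (fun o => o.1 = a) h1 (history (hacUCB T q) ω n hnT)
  rw [hv] at hle
  have hle' : (explore₁ A T : ℝ) ≤ actionCount (history (hacUCB T q) ω n hnT) a := by
    rw [actionCount_eq]
    exact le_max_of_le_right (Nat.cast_le.mpr hle)
  have he : (0 : ℝ) < explore₁ A T := Nat.cast_pos.mpr (explore₁_pos A hT)
  have hZ : (1 : ℝ) ≤ Fintype.card Z := by exact_mod_cast Fintype.card_pos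
  have hk := card_mul_log_le_explore₁_mul A Z hT
  have hκ := tolerance_nonneg A Z T
  have hsq : 4 * (Real.log T / actionCount (history (hacUCB T q) ω n hnT) a)
      ≤ tolerance A Z T ^ 2 := by
    calc _ ≤ 4 * (Real.log T / explore₁ A T) := by gcongr
      _ ≤ _ := by
        rw [← mul_div_assoc, div_le_iff₀ he]
        nlinarith
  have h2 : 2 * √(Real.log T / actionCount (history (hacUCB T q) ω n hnT) a)
      = √(4 * (Real.log T / actionCount (history (hacUCB T q) ω n hnT) a)) := by
    rw [Real.sqrt_mul (by norm_num), show (4 : ℝ) = 2 ^ 2 by norm_num, Real.sqrt_sq (by norm_num)]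
  rw [h2]
  exact Real.sqrt_le_iff.mpr ⟨hκ, hsq⟩

/-- The `3 * tolerance` is two from the test and one from the width of the comparison action; the
`6` is the factor 2 of the context width times the error of three tolerances in the working
marginals. -/
theorem regret_hacUCB_le [Nonempty Z] (ν : Env A Z) (q : A → ProbabilityMeasure Z)
    (hT : 3 ≤ T) :
    regret ν (hacUCB T q) ≤ exploreTotal A T
      + T * (Fintype.card A * (2 / T) + Fintype.card A * (2 / (T : ℝ) ^ 2))
      + T * (3 * tolerance A Z T + 6 * √(Real.log T) * tolerance A Z T)
      + 2 * √(Real.log T) * (3 * √(Fintype.card A * T))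
      + 2 * √(Real.log T) * (3 * √(Fintype.card Z * T)) := by
  have hκ := tolerance_nonneg A Z T
  have hT0 : 0 < T := by omega
  refine regret_le ν _ (bad := atypical ν q T) (by positivity) (measure_atypical_le ν q hT)
    (by positivity) (by positivity) (by positivity) fun ω hω t ht a => ?_
  have hA := actionsWithin_of_notMem_atypical hω t t.isLt.le
  have hpl := playedAction_hacUCB q ω t ht
  have hwidth := mul_nonneg (Real.sqrt_nonneg (Real.log T))
    (contextWidth_mem_Icc ν (hacUCB T q) t ω).1
  have hrest : 0 ≤ √(Real.log T) * tolerance A Z T := by positivity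
  split_ifs at hpl with hf
  · have h := meanReward_le_of_testPasses hA hT0 (testPasses_of_flagUp ht hf) a hpl
      (sum_abs_workingMarginals_le (fun a => mle_close_of_notMem_atypical hω ht t.isLt.le a) _)
    have h2 := sqrt_log_div_actionCount_le q ω hT0 ht t.isLt.le a
    rw [sum_sqrt_mul_contextProb,
      sqrt_log_div_eq (actionCount _ (playedAction (hacUCB T q) ω t))] at h
    linarith
  · have h := meanReward_le_of_argmax_ucbAction hA hT0 a
    rw [← hpl, sqrt_log_div_eq] at h
    linarith

theorem regret_hacUCB_le_of_benign [Nonempty Z] {ν : Env A Z} (q : A → ProbabilityMeasure Z)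
    (hT : 3 ≤ T) (hν : ConditionallyBenign ν) {ε : ℝ} (hε : ε ≤ tolerance A Z T)
    (hclose : EpsClose q ν ε) :
    regret ν (hacUCB T q) ≤ exploreTotal A T
      + T * (Fintype.card A * (2 / T) + Fintype.card A * (2 / (T : ℝ) ^ 2)
        + Fintype.card Z * (2 / T))
      + T * (2 * ε * (1 + √(Real.log T)))
      + 2 * √(Real.log T) * (3 * √(Fintype.card Z * T)) := by
  have hT0 : 0 < T := by omega
  have hε0 : 0 ≤ ε := (Finset.sum_nonneg fun z _ => abs_nonneg _).trans
    (hclose (Classical.arbitrary A))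
  obtain ⟨m, hm01, hm⟩ := exists_conditional_mean hν
  have hmean : ∀ a, meanReward ν a = ∑ z, m z * contextProb ν a z := fun a =>
    meanReward_eq_sum ν a (hm a)
  have hbad : outcomeLaw ν T (atypical ν q T ∪
      {ω | ∃ (n : ℕ) (hn : n ≤ T), ¬ ContextsWithin m T (history (hacUCB T q) ω n hn)})
      ≤ ENNReal.ofReal (Fintype.card A * (2 / T) + Fintype.card A * (2 / (T : ℝ) ^ 2)
        + Fintype.card Z * (2 / T)) := by
    rw [ENNReal.ofReal_add (by positivity) (by positivity)]
    exact (measure_union_le _ _).trans (add_le_add (measure_atypical_le ν q hT)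
      (measure_not_contextsWithin_le ν _ hT hm01 hm))
  have h := regret_le ν (hacUCB T q) (n₀ := exploreTotal A T)
    (c₀ := 2 * ε * (1 + √(Real.log T))) (c₁ := 0) (c₂ := 2 * √(Real.log T)) (by positivity) hbad
    (by positivity) le_rfl (by positivity) fun ω hω t ht a => ?_
  · linarith
  have hω1 : ω ∉ atypical ν q T := fun h => hω (Or.inl h)
  have hC : ∀ (n : ℕ) (hn : n ≤ T), ContextsWithin m T (history (hacUCB T q) ω n hn) :=
    fun n hn => by
      by_contra h
      exact hω (Or.inr ⟨n, hn, h⟩)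
  have hw0 : ∀ a z, 0 ≤ marginalWeights q a z := fun a z => measureReal_nonneg
  have hW : ∀ (n : ℕ) (hn : n ≤ T), exploreTotal A T ≤ n →
      workingMarginals T (marginalWeights q) (history (hacUCB T q) ω n hn) = marginalWeights q :=
    fun n hn he => workingMarginals_eq_self
      (fun a => mle_close_of_notMem_atypical hω1 he hn a) fun a => (hclose a).trans hε
  have hflag : FlagUp T (marginalWeights q) (history (hacUCB T q) ω t t.isLt.le) := by
    -- The flag concerns every test since the exploration, so validity at all prefixes is used, not
    -- only at time `t`.
    intro k hk
    rw [history_comp_castLE]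
    have hkT : (k : ℕ) ≤ T := (Nat.le_of_lt_succ k.isLt).trans t.isLt.le
    exact testPasses_of_within (actionsWithin_of_notMem_atypical hω1 k hkT) (hC k hkT) hT0 hw0
      (hW k hkT hk) hmean hm01 hε hclose
  have hpl := playedAction_hacUCB q ω t ht
  rw [if_pos hflag, hW t t.isLt.le ht] at hpl
  have h := meanReward_le_of_argmax_pseudoUCB (hC t t.isLt.le) hT0 hw0 hmean hm01 hclose a hpl
  rw [sum_sqrt_mul_contextProb] at h
  linarith

end Regret

/-! ### Numerical estimates -/

section Numerics

theorem two_le_log {T : ℕ} (hT : 25 ≤ T) : 2 ≤ Real.log T := by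
  have hT0 : (0 : ℝ) < T := by positivity
  rw [Real.le_log_iff_exp_le hT0]
  have h25 : (25 : ℝ) ≤ T := by exact_mod_cast hT
  have h1 : Real.exp 2 = Real.exp 1 ^ 2 := by rw [← Real.exp_nat_mul]; norm_num
  rw [h1]
  nlinarith [Real.exp_one_lt_d9, Real.exp_pos 1]

theorem mul_tolerance_eq (A Z : Type*) [Fintype A] [Fintype Z] {T : ℕ} (hT : 0 < T) :
    T * tolerance A Z T
      = (T : ℝ) ^ (3 / 4 : ℝ) * √(Real.log T) * √(Fintype.card A * Fintype.card Z) := by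
  have hT0 : (0 : ℝ) < T := Nat.cast_pos.mpr hT
  have h : (T : ℝ) = (T : ℝ) ^ (3 / 4 : ℝ) * (T : ℝ) ^ (1 / 4 : ℝ) := by
    rw [← Real.rpow_add hT0]; norm_num
  have h4 : (T : ℝ) ^ (1 / 4 : ℝ) ≠ 0 := (Real.rpow_pos_of_pos hT0 _).ne'
  rw [tolerance, Real.sqrt_mul (by positivity)]
  nth_rw 1 [h]
  field_simp

theorem rpow_neg_mul_sqrt_eq_tolerance (A Z : Type*) [Fintype A] [Fintype Z] (T : ℕ) :
    (T : ℝ) ^ (-(1 / 4) : ℝ) * √(Fintype.card A * Fintype.card Z * Real.log T)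
      = tolerance A Z T := by
  rw [tolerance, Real.rpow_neg (Nat.cast_nonneg T), mul_comm, ← div_eq_mul_inv]

/-- Exploration and atypical outcomes cost at most `4 |A| + 4 log T √T`. -/
theorem exploreTotal_add_le (A : Type*) [Fintype A] [Nonempty A] {T : ℕ}
    (hT : 25 * Fintype.card A ^ 2 ≤ T) :
    exploreTotal A T + T * (Fintype.card A * (2 / T) + Fintype.card A * (2 / (T : ℝ) ^ 2))
      ≤ 4 * Fintype.card A + 4 * Real.log T * √(T : ℝ) := by
  have hA : 1 ≤ Fintype.card A := Fintype.card_pos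
  have hT25 : 25 ≤ T := by nlinarith
  have hTA : Fintype.card A ≤ T := by nlinarith
  have hT0 : (0 : ℝ) < T := by positivity
  have hTA' : (Fintype.card A : ℝ) ≤ T := by exact_mod_cast hTA
  have hL := two_le_log hT25
  have hs : 1 ≤ √(T : ℝ) := Real.one_le_sqrt.mpr (by exact_mod_cast (by omega : 1 ≤ T))
  have he := exploreTotal_le A T
  have h1 : (T : ℝ) * (Fintype.card A * (2 / T) + Fintype.card A * (2 / (T : ℝ) ^ 2))
      = 2 * Fintype.card A + 2 * (Fintype.card A / T) := by field_simp
  have h2 : (Fintype.card A : ℝ) / T ≤ 1 := (div_le_one hT0).mpr hTA'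
  rw [h1]
  -- After `exploreTotal_le` what remains is `5 * √T + 2 ≤ 4 * log T * √T`, true since `log T ≥ 2`
  -- and `√T ≥ 1`.
  nlinarith

end Numerics

end CausalBandit

/-! ### The theorem -/

theorem mainTheorem1 {A Z : Type*}
    [Fintype A] [LinearOrder A] [Nonempty A] [MeasurableSpace A] [DiscreteMeasurableSpace A]
    [Fintype Z] [DecidableEq Z] [MeasurableSpace Z] [DiscreteMeasurableSpace Z]
    (T : ℕ) (hT : 25 * Fintype.card A ^ 2 ≤ T)
    (ν : CausalBandit.Env A Z) (q : A → MeasureTheory.ProbabilityMeasure Z) :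
    CausalBandit.regret ν (CausalBandit.hacUCB T q)
        ≤ 4 * Fintype.card A
          + 11 * (T : ℝ) ^ (3 / 4 : ℝ) * Real.log T * √(Fintype.card A * Fintype.card Z)
          + 15 * √((Fintype.card A + Fintype.card Z) * T * Real.log T)
          + 5 * Real.log T * √T ∧
      ∀ ε : ℝ,
        ε ≤ (T : ℝ) ^ (-(1 / 4) : ℝ) * √(Fintype.card A * Fintype.card Z * Real.log T) →
        CausalBandit.ConditionallyBenign ν →
        CausalBandit.EpsClose q ν ε →
        CausalBandit.regret ν (CausalBandit.hacUCB T q)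
          ≤ 4 * Fintype.card A + 2 * Fintype.card Z
            + 6 * √(Fintype.card Z * T * Real.log T)
            + 4 * Real.log T * √T
            + 2 * ε * (1 + √(Real.log T)) * T := by
  have hZ : Nonempty Z :=
    ⟨((ν (Classical.arbitrary A) : Measure (Z × unitInterval)).nonempty_of_neZero).some.1⟩
  have hA : 1 ≤ Fintype.card A := Fintype.card_pos
  have hT25 : 25 ≤ T := by nlinarith
  have hT0 : (0 : ℝ) < T := by positivity
  have hL := CausalBandit.two_le_log hT25
  have hexp := CausalBandit.exploreTotal_add_le A hT
  have hsqrt : ∀ x : ℝ, 0 ≤ x →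
      2 * √(Real.log T) * (3 * √(x * T)) = 6 * √(x * T * Real.log T) := fun x hx => by
    rw [Real.sqrt_mul (by positivity) (Real.log T)]
    ring
  refine ⟨?_, fun ε hε hν hclose => ?_⟩
  · have h := CausalBandit.regret_hacUCB_le ν q (by omega : 3 ≤ T)
    rw [hsqrt _ (Nat.cast_nonneg _), hsqrt _ (Nat.cast_nonneg _)] at h
    have hA' : √(Fintype.card A * T * Real.log T)
        ≤ √((Fintype.card A + Fintype.card Z) * T * Real.log T) := by
      gcongr
      exact le_add_of_nonneg_right (Nat.cast_nonneg _)
    have hZ' : √(Fintype.card Z * T * Real.log T)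
        ≤ √((Fintype.card A + Fintype.card Z) * T * Real.log T) := by
      gcongr
      exact le_add_of_nonneg_left (Nat.cast_nonneg _)
    have htol := CausalBandit.mul_tolerance_eq A Z (by omega : 0 < T)
    have hl1 : 1 ≤ √(Real.log T) := Real.one_le_sqrt.mpr (by linarith)
    have hl2 : √(Real.log T) * √(Real.log T) = Real.log T := Real.mul_self_sqrt (by linarith)
    have hkey : T * (3 * CausalBandit.tolerance A Z T
        + 6 * √(Real.log T) * CausalBandit.tolerance A Z T)
        ≤ 11 * (T : ℝ) ^ (3 / 4 : ℝ) * Real.log T * √(Fintype.card A * Fintype.card Z) := by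
      calc _ = (T * CausalBandit.tolerance A Z T) * (3 + 6 * √(Real.log T)) := by ring
        _ ≤ (T * CausalBandit.tolerance A Z T) * (11 * √(Real.log T)) := by
            -- `√(log T) ≥ 1` gives `3 + 6 * √(log T) ≤ 9 * √(log T)`, so the constant 11 leaves
            -- room.
            refine mul_le_mul_of_nonneg_left (by linarith) ?_
            exact mul_nonneg hT0.le (CausalBandit.tolerance_nonneg A Z T)
        _ = 11 * (T : ℝ) ^ (3 / 4 : ℝ) * (√(Real.log T) * √(Real.log T))
              * √(Fintype.card A * Fintype.card Z) := by rw [htol]; ring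
        _ = _ := by rw [hl2]
    have hpos : 0 ≤ Real.log T * √(T : ℝ) := by positivity
    have hpos2 := Real.sqrt_nonneg (((Fintype.card A : ℝ) + Fintype.card Z) * T * Real.log T)
    linarith
  · rw [CausalBandit.rpow_neg_mul_sqrt_eq_tolerance] at hε
    have h := CausalBandit.regret_hacUCB_le_of_benign q (by omega : 3 ≤ T) hν hε hclose
    rw [hsqrt _ (Nat.cast_nonneg _), mul_add (T : ℝ) (_ + _)] at h
    have hz : (T : ℝ) * (Fintype.card Z * (2 / T)) = 2 * Fintype.card Z := by field_simp
    rw [hz] at h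
    linarith
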